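/- Let $d,m\in\mathbb N$, $T>0$, let $0<\beta,\mu,\delta\le 1$ satisfy $\min\{\beta,\frac{\delta}{1+\delta}\}>1-\mu$, and let $$0<1-\mu<\alpha<\alpha_0:=\min\Big\{\tfrac12,\beta,\tfrac{\delta}{1+\delta}\Big\}.$$ **Spaces.** $W_0^{\alpha,\infty}(0,T;\mathbb R^d)$ is the space of measurable $f:[0,T]\to\mathbb R^d$ with $$\|f\|_{\alpha,\infty}:=\sup_{t\in[0,T]}\Big(|f(t)|+\int_0^t\frac{|f(t)-f(s)|}{(t-s)^{\alpha+1}}\,ds\Big)<\infty,$$ and $W_T^{1-\alpha,\infty}(0,T;\mathbb R^m)$ is the space of measurable $g:[0,T]\to\mathbb R^m$ with $$\sup_{0<s<t<T}\Big(\frac{|g(t)-g(s)|}{(t-s)^{1-\alpha}}+\int_s^t\frac{|g(y)-g(s)|}{(y-s)^{2-\alpha}}\,dy\Big)<\infty .$$ **Integral.** For such $g$ (with $g(t-)$ the left limit) and for real $f$ let $$D^{\alpha}_{0+}f(s)=\frac{1}{\Gamma(1-\alpha)}\Big(\frac{f(s)}{s^\alpha}+\alpha\int_0^s\frac{f(s)-f(y)}{(s-y)^{\alpha+1}}dy\Big),$$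 $$D^{1-\alpha}_{t-}g_{t-}(s)=\frac{(-1)^{1-\alpha}}{\Gamma(\alpha)}\Big(\frac{g(s)-g(t-)}{(t-s)^{1-\alpha}}+(1-\alpha)\int_s^t\frac{g(s)-g(y)}{(y-s)^{2-\alpha}}dy\Big),$$ $$\Lambda_\alpha(g)=\frac{1}{\Gamma(1-\alpha)}\sup_{0<s<t<T}\big|D^{1-\alpha}_{t-}g_{t-}(s)\big| .$$ For scalar $g$ put $\int_0^T f\,dg=(-1)^\alpha\int_0^T D^\alpha_{0+}f(s)\,D^{1-\alpha}_{T-}g_{T-}(s)\,ds$ and $\int_0^t f\,dg=\int_0^T f\,1_{(0,t)}\,dg$ (with $(-1)^\alpha(-1)^{1-\alpha}=-1$); for matrix-valued $f$ and vector-valued $g$ the integral is taken componentwise, $(\int f\,dg)_i=\sum_j\int f_{ij}\,dg^j$. **Hypotheses.** All $s,t,s_i,t_i$ range over $[0,T]$ and all $x,y,x_i$ over $\mathbb R^d$, unless restricted. (H1) $\sigma:[0,T]^2\times\mathbb R^d\to\mathbb R^{d\times m}$ is measurable, the derivatives $\partial_{x_i}\sigma,\partial_t\sigma,\partial^2_{x_i,t}\sigma$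 ($1\le i\le d$) exist, and there are $K>0$ and, for every $N\ge0$, $K_N>0$ such that for $i=1,\dots,d$: 1. $|\sigma(t,s,x)-\sigma(t,s,y)|+|\partial_t\sigma(t,s,x)-\partial_t\sigma(t,s,y)|\le K|x-y|$; 2. $|\partial_{x_i}\sigma(t,s,x)-\partial_{x_i}\sigma(t,s,y)|+|\partial^2_{x_i,t}\sigma(t,s,x)-\partial^2_{x_i,t}\sigma(t,s,y)|\le K_N|x-y|^\delta$ for $|x|,|y|\le N$; 3. $|\sigma(t_1,s,x)-\sigma(t_2,s,x)|+|\partial_{x_i}\sigma(t_1,s,x)-\partial_{x_i}\sigma(t_2,s,x)|\le K|t_1-t_2|^\mu$; 4. $|\sigma(t,s_1,x)-\sigma(t,s_2,x)|+|\partial_t\sigma(t,s_1,x)-\partial_t\sigma(t,s_2,x)|\le K|s_1-s_2|^\beta$; 5. $|\partial^2_{x_i,t}\sigma(t,s_1,x)-\partial^2_{x_i,t}\sigma(t,s_2,x)|+|\partial_{x_i}\sigma(t,s_1,x)-\partial_{x_i}\sigma(t,s_2,x)|\le K|s_1-s_2|^\beta$. (H2) $b:[0,T]^2\times\mathbb R^d\to\mathbb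 R^d$ is measurable, and there are $b_0\in L^{1/\alpha}([0,T]^2;\mathbb R)$, $L,L_0>0$ and, for every $N\ge0$, $L_N>0$ such that: 1. $|b(t,s,x)-b(t,s,y)|\le L_N|x-y|$ for $|x|,|y|\le N$; 2. $|b(t_1,s,x)-b(t_2,s,x)|\le L|t_1-t_2|^\mu$; 3. $|b(t,s,x)|\le L_0|x|+b_0(t,s)$; 4. $|b(t_1,s,x_1)-b(t_1,s,x_2)-b(t_2,s,x_1)+b(t_2,s,x_2)|\le L_N|t_1-t_2||x_1-x_2|$ for $|x_1|,|x_2|\le N$. (H3) There are $\gamma\in[0,1]$ and $K_0>0$ with $|\sigma(t,s,x)|\le K_0(1+|x|^\gamma)$. **Exponent.** Let $\varphi=\varphi(\alpha,\gamma)$ be $\frac1{1-\alpha}$ if $0\le\gamma<\frac{1-2\alpha}{1-\alpha}$; any fixed number $>\frac1{1-2\alpha}$ if $\frac{1-2\alpha}{1-\alpha}\le\gamma<1$; and $\frac1{1-2\alpha}$ if $\gamma=1$. **Proposition.** Under (H1), (H2), (H3), let $g\in W_T^{1-\alpha,\infty}(0,T;\mathbb R^m)$, $x_0\in\mathbb R^d$.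 Then every solution $x\in W_0^{\alpha,\infty}(0,T;\mathbb R^d)$ of $$x(t)=x_0+\int_0^t b(t,s,x(s))\,ds+\int_0^t\sigma(t,s,x(s))\,dg_s,\qquad t\in[0,T],$$ satisfies $$\|x\|_{\alpha,\infty}\le C^{(5)}_\alpha\,(1+|x_0|)\,\exp\!\big(C^{(6)}_\alpha\,\Lambda_\alpha(g)^{\varphi(\alpha,\gamma)}\big),$$ where the positive constants $C^{(5)}_\alpha,C^{(6)}_\alpha$ depend only on $d,m,T,\alpha,\gamma$ (and on the choice of $\varphi$ in the middle case) and on the constants in (H1)–(H3), namely $\beta,\mu,\delta,K,(K_N)_N,L,L_0,(L_N)_N,K_0$ and an upper bound for $\|b_0\|_{L^{1/\alpha}([0,T]^2)}$; they do not depend on $b,\sigma,g,x_0,x$ otherwise. -/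

import Mathlib

open MeasureTheory Set

noncomputable section

namespace Volterra

/-- `ℝ^d` with the Euclidean norm. -/
abbrev Vec (d : ℕ) : Type := EuclideanSpace ℝ (Fin d)

/-- Real `d × m` matrices with the Euclidean (Frobenius) norm; `A (i, j)` is the `(i, j)` entry. -/
abbrev Mat (d m : ℕ) : Type := EuclideanSpace ℝ (Fin d × Fin m)

/-! ### Function spaces -/

/-- `‖f‖_{α,∞} = sup_{t ∈ [0,T]} (|f t| + ∫_0^t |f t - f s| / (t - s)^{α+1} ds)`,
with values in `[0, ∞]`. -/
def normW0 {E : Type*} [NormedAddCommGroup E] (T α : ℝ) (f : ℝ → E) : ENNReal :=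
  ⨆ t ∈ Icc (0 : ℝ) T,
    (ENNReal.ofReal ‖f t‖ +
      ∫⁻ s in Ioo (0 : ℝ) t, ENNReal.ofReal (‖f t - f s‖ / (t - s) ^ (α + 1)))

/-- The space `W_0^{α,∞}(0,T;E)` of measurable `f : [0,T] → E` with `‖f‖_{α,∞} < ∞`. -/
structure MemW0 {E : Type*} [NormedAddCommGroup E] (T α : ℝ) (f : ℝ → E) : Prop where
  measurable : AEStronglyMeasurable f (volume.restrict (Icc (0 : ℝ) T))
  norm_lt_top : normW0 T α f < ⊤

/-- `‖g‖_{1-α,∞,T} = sup_{0<s<t<T} (|g t - g s| / (t-s)^{1-α} + ∫_s^t |g y - g s| / (y-s)^{2-α} dy)`,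
with values in `[0, ∞]`. -/
def normWT {E : Type*} [NormedAddCommGroup E] (T α : ℝ) (g : ℝ → E) : ENNReal :=
  ⨆ (s : ℝ) (t : ℝ) (_ : 0 < s) (_ : s < t) (_ : t < T),
    (ENNReal.ofReal (‖g t - g s‖ / (t - s) ^ (1 - α)) +
      ∫⁻ y in Ioo s t, ENNReal.ofReal (‖g y - g s‖ / (y - s) ^ (2 - α)))

/-- The space `W_T^{1-α,∞}(0,T;E)` of measurable `g : [0,T] → E` with `‖g‖_{1-α,∞,T} < ∞`. -/
structure MemWT {E : Type*} [NormedAddCommGroup E] (T α : ℝ) (g : ℝ → E) : Prop where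
  measurable : AEStronglyMeasurable g (volume.restrict (Icc (0 : ℝ) T))
  norm_lt_top : normWT T α g < ⊤

/-! ### Weyl derivatives and the generalized Stieltjes integral -/

/-- The left-sided Weyl derivative `D^a_{0+} f` at `s > 0`:
`1/Γ(1-a) (f(s)/s^a + a ∫_0^s (f(s)-f(y))/(s-y)^{a+1} dy)`. -/
def weylLeft (a : ℝ) (f : ℝ → ℝ) (s : ℝ) : ℝ :=
  1 / Real.Gamma (1 - a) *
    (f s / s ^ a + a * ∫ y in (0 : ℝ)..s, (f s - f y) / (s - y) ^ (a + 1))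

/-- The right-sided Weyl derivative `D^a_{t-} g_{t-}` at `s < t`, where `g_{t-} = g - g(t-)` and
`g(t-)` is the left limit, without its unimodular factor `(-1)^a`:
`1/Γ(1-a) ((g(s)-g(t-))/(t-s)^a + a ∫_s^t (g(s)-g(y))/(y-s)^{a+1} dy)`. -/
def weylRight {E : Type*} [NormedAddCommGroup E] [NormedSpace ℝ E]
    (a : ℝ) (g : ℝ → E) (t s : ℝ) : E :=
  (1 / Real.Gamma (1 - a)) •
    (((t - s) ^ a)⁻¹ • (g s - Function.leftLim g t) +
      a • ∫ y in s..t, ((y - s) ^ (a + 1))⁻¹ • (g s - g y))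

/-- `Λ_α(g) = 1/Γ(1-α) sup_{0<s<t<T} |D^{1-α}_{t-} g_{t-}(s)|`. The supremum is finite for
`g` in `W_T^{1-α,∞}`. -/
def Lam {E : Type*} [NormedAddCommGroup E] [NormedSpace ℝ E] (T α : ℝ) (g : ℝ → E) : ℝ :=
  1 / Real.Gamma (1 - α) *
    sSup {r : ℝ | ∃ s t : ℝ, 0 < s ∧ s < t ∧ t < T ∧ r = ‖weylRight (1 - α) g t s‖}

/-- The generalized Stieltjes integral
`∫_0^T f dg = (-1)^α ∫_0^T D^α_{0+} f(s) D^{1-α}_{T-} g_{T-}(s) ds`. The factors `(-1)^α` and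
`(-1)^{1-α}` (the latter is left out of `weylRight`) multiply to `-1`. -/
def stieltjes (T α : ℝ) (f g : ℝ → ℝ) : ℝ :=
  -∫ s in (0 : ℝ)..T, weylLeft α f s * weylRight (1 - α) g T s

/-- `∫_0^t f dg = ∫_0^T f 1_{(0,t)} dg`. -/
def stieltjesTo (T α : ℝ) (f g : ℝ → ℝ) (t : ℝ) : ℝ :=
  stieltjes T α ((Ioo (0 : ℝ) t).indicator f) g

/-! ### The coefficients -/

/-- `∂_t σ(t,s,x)`, the derivative in the first variable on `[0,T]` (one-sided at `0` and `T`). -/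
def dt {d m : ℕ} (T : ℝ) (σ : ℝ → ℝ → Vec d → Mat d m) (t s : ℝ) (x : Vec d) : Mat d m :=
  derivWithin (fun r => σ r s x) (Icc (0 : ℝ) T) t

/-- `∂_{x_i} σ(t,s,x)`. -/
def dx {d m : ℕ} (σ : ℝ → ℝ → Vec d → Mat d m) (i : Fin d) (t s : ℝ) (x : Vec d) : Mat d m :=
  lineDeriv ℝ (σ t s) x (EuclideanSpace.single i (1 : ℝ))

/-- `∂²_{x_i,t} σ(t,s,x)`, the derivative of `∂_{x_i} σ` in the first variable. -/
def dxt {d m : ℕ} (T : ℝ) (σ : ℝ → ℝ → Vec d → Mat d m) (i : Fin d) (t s : ℝ) (x : Vec d) :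
    Mat d m :=
  derivWithin (fun r => dx σ i r s x) (Icc (0 : ℝ) T) t

/-- Hypothesis (H1) on `σ : [0,T]² × ℝ^d → ℝ^{d×m}` with constants `β, μ, δ, K, (K_N)_{N ≥ 0}`.
Only the values of `σ` on `[0,T]² × ℝ^d` are constrained. -/
structure H1 {d m : ℕ} (T β μ δ K : ℝ) (KN : ℝ → ℝ) (σ : ℝ → ℝ → Vec d → Mat d m) : Prop where
  measurable : Measurable
    (fun p : Icc (0 : ℝ) T × Icc (0 : ℝ) T × Vec d => σ (p.1 : ℝ) (p.2.1 : ℝ) p.2.2)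
  exists_dt : ∀ t ∈ Icc (0 : ℝ) T, ∀ s ∈ Icc (0 : ℝ) T, ∀ x : Vec d,
    DifferentiableWithinAt ℝ (fun r => σ r s x) (Icc (0 : ℝ) T) t
  exists_dx : ∀ t ∈ Icc (0 : ℝ) T, ∀ s ∈ Icc (0 : ℝ) T, ∀ x : Vec d, ∀ i : Fin d,
    LineDifferentiableAt ℝ (σ t s) x (EuclideanSpace.single i (1 : ℝ))
  exists_dxt : ∀ t ∈ Icc (0 : ℝ) T, ∀ s ∈ Icc (0 : ℝ) T, ∀ x : Vec d, ∀ i : Fin d,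
    DifferentiableWithinAt ℝ (fun r => dx σ i r s x) (Icc (0 : ℝ) T) t
  lipschitz_x : ∀ t ∈ Icc (0 : ℝ) T, ∀ s ∈ Icc (0 : ℝ) T, ∀ x y : Vec d,
    ‖σ t s x - σ t s y‖ + ‖dt T σ t s x - dt T σ t s y‖ ≤ K * ‖x - y‖
  holder_dx : ∀ N : ℝ, 0 ≤ N → ∀ t ∈ Icc (0 : ℝ) T, ∀ s ∈ Icc (0 : ℝ) T, ∀ x y : Vec d,
    ‖x‖ ≤ N → ‖y‖ ≤ N → ∀ i : Fin d,
    ‖dx σ i t s x - dx σ i t s y‖ + ‖dxt T σ i t s x - dxt T σ i t s y‖ ≤ KN N * ‖x - y‖ ^ δ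
  holder_t : ∀ t₁ ∈ Icc (0 : ℝ) T, ∀ t₂ ∈ Icc (0 : ℝ) T, ∀ s ∈ Icc (0 : ℝ) T, ∀ x : Vec d,
    ∀ i : Fin d,
    ‖σ t₁ s x - σ t₂ s x‖ + ‖dx σ i t₁ s x - dx σ i t₂ s x‖ ≤ K * |t₁ - t₂| ^ μ
  holder_s : ∀ t ∈ Icc (0 : ℝ) T, ∀ s₁ ∈ Icc (0 : ℝ) T, ∀ s₂ ∈ Icc (0 : ℝ) T, ∀ x : Vec d,
    ‖σ t s₁ x - σ t s₂ x‖ + ‖dt T σ t s₁ x - dt T σ t s₂ x‖ ≤ K * |s₁ - s₂| ^ β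
  holder_s_dx : ∀ t ∈ Icc (0 : ℝ) T, ∀ s₁ ∈ Icc (0 : ℝ) T, ∀ s₂ ∈ Icc (0 : ℝ) T, ∀ x : Vec d,
    ∀ i : Fin d,
    ‖dxt T σ i t s₁ x - dxt T σ i t s₂ x‖ + ‖dx σ i t s₁ x - dx σ i t s₂ x‖ ≤ K * |s₁ - s₂| ^ β

/-- Hypothesis (H2) on `b : [0,T]² × ℝ^d → ℝ^d` with exponents `ρ, μ` and constants
`L, L₀, (L_N)_{N ≥ 0}` and a bound `B` for the norm of `b₀` in `L^ρ([0,T]²)`.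
Only the values of `b` on `[0,T]² × ℝ^d` are constrained. -/
structure H2 {d : ℕ} (T ρ μ L L₀ : ℝ) (LN : ℝ → ℝ) (B : NNReal)
    (b : ℝ → ℝ → Vec d → Vec d) : Prop where
  measurable : Measurable
    (fun p : Icc (0 : ℝ) T × Icc (0 : ℝ) T × Vec d => b (p.1 : ℝ) (p.2.1 : ℝ) p.2.2)
  lipschitz_x : ∀ N : ℝ, 0 ≤ N → ∀ t ∈ Icc (0 : ℝ) T, ∀ s ∈ Icc (0 : ℝ) T, ∀ x y : Vec d,
    ‖x‖ ≤ N → ‖y‖ ≤ N → ‖b t s x - b t s y‖ ≤ LN N * ‖x - y‖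
  holder_t : ∀ t₁ ∈ Icc (0 : ℝ) T, ∀ t₂ ∈ Icc (0 : ℝ) T, ∀ s ∈ Icc (0 : ℝ) T, ∀ x : Vec d,
    ‖b t₁ s x - b t₂ s x‖ ≤ L * |t₁ - t₂| ^ μ
  growth : ∃ b₀ : ℝ × ℝ → ℝ,
    MemLp b₀ (ENNReal.ofReal ρ) (volume.restrict (Icc (0 : ℝ) T ×ˢ Icc (0 : ℝ) T)) ∧
    eLpNorm b₀ (ENNReal.ofReal ρ) (volume.restrict (Icc (0 : ℝ) T ×ˢ Icc (0 : ℝ) T)) ≤ B ∧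
    ∀ t ∈ Icc (0 : ℝ) T, ∀ s ∈ Icc (0 : ℝ) T, ∀ x : Vec d, ‖b t s x‖ ≤ L₀ * ‖x‖ + b₀ (t, s)
  mixed : ∀ N : ℝ, 0 ≤ N → ∀ t₁ ∈ Icc (0 : ℝ) T, ∀ t₂ ∈ Icc (0 : ℝ) T, ∀ s ∈ Icc (0 : ℝ) T,
    ∀ x₁ x₂ : Vec d, ‖x₁‖ ≤ N → ‖x₂‖ ≤ N →
    ‖b t₁ s x₁ - b t₁ s x₂ - b t₂ s x₁ + b t₂ s x₂‖ ≤ LN N * |t₁ - t₂| * ‖x₁ - x₂‖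

/-- Hypothesis (H3): `|σ(t,s,x)| ≤ K₀ (1 + |x|^γ)` on `[0,T]² × ℝ^d`. -/
def H3 {d m : ℕ} (T γ K₀ : ℝ) (σ : ℝ → ℝ → Vec d → Mat d m) : Prop :=
  ∀ t ∈ Icc (0 : ℝ) T, ∀ s ∈ Icc (0 : ℝ) T, ∀ x : Vec d, ‖σ t s x‖ ≤ K₀ * (1 + ‖x‖ ^ γ)

/-! ### The equation and the exponent -/

/-- `x ∈ W_0^{α,∞}(0,T;ℝ^d)` solves
`x(t) = x₀ + ∫_0^t b(t,s,x(s)) ds + ∫_0^t σ(t,s,x(s)) dg_s` for all `t ∈ [0,T]`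
(written in coordinates). -/
structure IsSolution {d m : ℕ} (T α : ℝ) (b : ℝ → ℝ → Vec d → Vec d)
    (σ : ℝ → ℝ → Vec d → Mat d m) (g : ℝ → Vec m) (x₀ : Vec d) (x : ℝ → Vec d) : Prop where
  mem : MemW0 T α x
  eq : ∀ t ∈ Icc (0 : ℝ) T, ∀ i : Fin d,
    x t i = x₀ i + (∫ s in (0 : ℝ)..t, b t s (x s) i) +
      ∑ j : Fin m, stieltjesTo T α (fun s => σ t s (x s) (i, j)) (fun s => g s j) t

/-- `φ` is an admissible value of the exponent `φ(α,γ)`: it equals `1/(1-α)` for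
`0 ≤ γ < (1-2α)/(1-α)`, is any number larger than `1/(1-2α)` for `(1-2α)/(1-α) ≤ γ < 1`, and equals
`1/(1-2α)` for `γ = 1`. -/
def IsExponent (α γ φ : ℝ) : Prop :=
  (0 ≤ γ ∧ γ < (1 - 2 * α) / (1 - α) ∧ φ = 1 / (1 - α)) ∨
  ((1 - 2 * α) / (1 - α) ≤ γ ∧ γ < 1 ∧ 1 / (1 - 2 * α) < φ) ∨
  (γ = 1 ∧ φ = 1 / (1 - 2 * α))

end Volterra

end

/-!
The solution is bounded in exponentially weighted norms. Write `κ = 1 - α`, let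
`ψ(t) = ∫_0^t |x(t) - x(s)| / (t - s)^{α+1} ds` be the singular part of the norm, and suppose that
`|x(t)| ≤ R e^{λt}` and `ψ(t) ≤ R λ^α e^{λt}` on `[0, T]`. Inserting these bounds into the equation
gives, for `s < t`,

  `|x(t) - x(s)| ≤ C (t-s)^κ + (C R / M) e^{λt} (λ^κ min(1/λ, t-s)^κ + (t-s)^κ)`

as soon as `λ ≥ M` and `M Λ_α(g) ≤ λ^κ` (`IsSolution.norm_sub_le`). Dividing by `(t-s)^{α+1}` and
integrating reproduces the two bounds with `A + R / 2` in place of `R` if `M` is large, where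
`A` is at most a multiple of `1 + |x₀|` (`singularPart_le_of_norm_sub_le`). Since the norm of `x` is finite, the
bounds hold for some `R` to begin with, hence with `R = 1 + 2 A`
(`bound_of_half_contraction`, `IsSolution.normW0_le`). Taking `λ` of order `1 + Λ_α(g)^{1/κ}` yields
the exponential bound with the exponent `1 / (1 - α)`, which every admissible `φ` dominates
(`IsExponent.one_div_le`); of the growth condition only its linear consequence is needed.

Three points carry the increment estimate.

* The stochastic integral over `[s, t]` is the integral over `[0, T]` of a cut-off integrand. No
  additivity over intervals and no integration by parts is used: the Weyl derivative of `f 1_{[s,t)}` is estimated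
  directly, its part beyond `t` costing the kernel `(t-u)^{-α}` besides the usual `(u-s)^{-α}`
  (`weylMass_indicator_le`). The increment splits into the integrals of
  `(σ(t,·) - σ(s,·)) 1_{[0,s)}` and `σ(t,·) 1_{[s,t)}`, and the first one is controlled by the mean
  value theorem in the first variable (`enorm_stieltjesTo_sub_le`).
* The weight `e^{λt}` turns those kernels into `min(1/λ, t-s)^κ` (`lintegral_exp_mul_kernel_le`).
* The right Weyl derivative of `g` is bounded by `Γ(1-α) Λ_α(g)` up to the end point `T`, where it
  is a limit (`MemWT.norm_weylRight_end_le`).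

The drift is handled by averaging its growth bound over the first variable (`H2.lintegral_le`).
Most estimates are stated for integrals with values in `[0, ∞]`, which makes integrability an issue
only where differences of integrals are formed.
-/

noncomputable section

namespace Volterra

/-! ### Power and exponential kernels -/

theorem lintegral_Ioo_ofReal {a b : ℝ} (hab : a ≤ b) {f : ℝ → ℝ}
    (hf : IntervalIntegrable f volume a b) (h0 : ∀ u ∈ Ioo a b, 0 ≤ f u) :
    ∫⁻ u in Ioo a b, ENNReal.ofReal (f u) = ENNReal.ofReal (∫ u in a..b, f u) := by
  rw [intervalIntegral.integral_of_le hab, integral_Ioc_eq_integral_Ioo,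
    ofReal_integral_eq_lintegral_ofReal]
  · exact (intervalIntegrable_iff_integrableOn_Ioo_of_le hab).1 hf
  · exact (ae_restrict_iff' measurableSet_Ioo).2 (Filter.Eventually.of_forall h0)

theorem lintegral_Ioo_sub_left_rpow {r a b : ℝ} (hr : -1 < r) (hab : a ≤ b) :
    ∫⁻ u in Ioo a b, ENNReal.ofReal ((u - a) ^ r)
      = ENNReal.ofReal ((b - a) ^ (r + 1) / (r + 1)) := by
  have h1 : IntervalIntegrable (fun u => (u - a) ^ r) volume a b := by
    have := (intervalIntegral.intervalIntegrable_rpow' (a := 0) (b := b - a) hr).comp_sub_right a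
    simpa using this
  rw [lintegral_Ioo_ofReal hab h1 fun u hu => Real.rpow_nonneg (sub_nonneg.2 hu.1.le) _,
    intervalIntegral.integral_comp_sub_right (fun v => v ^ r) a, integral_rpow (Or.inl hr),
    sub_self, Real.zero_rpow (by linarith), sub_zero]

theorem lintegral_Ioo_sub_right_rpow {r a b : ℝ} (hr : -1 < r) (hab : a ≤ b) :
    ∫⁻ u in Ioo a b, ENNReal.ofReal ((b - u) ^ r)
      = ENNReal.ofReal ((b - a) ^ (r + 1) / (r + 1)) := by
  have h1 : IntervalIntegrable (fun u => (b - u) ^ r) volume a b := by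
    have := (intervalIntegral.intervalIntegrable_rpow' (a := b - a) (b := 0) hr).comp_sub_left b
    simpa using this
  rw [lintegral_Ioo_ofReal hab h1 fun u hu => Real.rpow_nonneg (sub_nonneg.2 hu.2.le) _,
    intervalIntegral.integral_comp_sub_left (fun v => v ^ r) b, integral_rpow (Or.inl hr),
    sub_self, Real.zero_rpow (by linarith), sub_zero]

theorem integral_rpow_le_of_lt_neg_one {r p q : ℝ} (hr : r < -1) (hp : 0 < p) (hpq : p ≤ q) :
    ∫ u in p..q, u ^ r ≤ p ^ (r + 1) / -(r + 1) := by
  have h0 : (0 : ℝ) ∉ uIcc p q := by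
    rw [uIcc_of_le hpq]; exact fun h => absurd h.1 (not_le.2 hp)
  rw [integral_rpow (Or.inr ⟨hr.ne, h0⟩), div_neg, ← neg_div,
    ← neg_div_neg_eq (q ^ (r + 1) - p ^ (r + 1)), ← neg_div_neg_eq (-p ^ (r + 1)), neg_neg]
  have : 0 ≤ q ^ (r + 1) := Real.rpow_nonneg (hp.le.trans hpq) _
  exact div_le_div_of_nonneg_right (by linarith) (by linarith)

theorem lintegral_Ioo_sub_left_rpow_le {r a b c : ℝ} (hr : r < -1) (hac : a < c) :
    ∫⁻ u in Ioo c b, ENNReal.ofReal ((u - a) ^ r)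
      ≤ ENNReal.ofReal ((c - a) ^ (r + 1) / -(r + 1)) := by
  rcases le_or_gt b c with hbc | hcb
  · simp [Ioo_eq_empty (not_lt.2 hbc)]
  have h1 : IntervalIntegrable (fun u => (u - a) ^ r) volume c b := by
    refine ContinuousOn.intervalIntegrable fun u hu => ?_
    rw [uIcc_of_le hcb.le] at hu
    have : u - a ≠ 0 := by linarith [hu.1]
    exact ((continuousAt_id.sub continuousAt_const).rpow_const (Or.inl this)).continuousWithinAt
  rw [lintegral_Ioo_ofReal hcb.le h1 fun u hu => Real.rpow_nonneg (by linarith [hu.1]) _,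
    intervalIntegral.integral_comp_sub_right (fun v => v ^ r) a]
  exact ENNReal.ofReal_le_ofReal
    (integral_rpow_le_of_lt_neg_one hr (by linarith) (by linarith))

theorem lintegral_Ioo_sub_right_rpow_le {r a b c : ℝ} (hr : r < -1) (hac : c < a) :
    ∫⁻ u in Ioo b c, ENNReal.ofReal ((a - u) ^ r)
      ≤ ENNReal.ofReal ((a - c) ^ (r + 1) / -(r + 1)) := by
  rcases le_or_gt c b with hbc | hcb
  · simp [Ioo_eq_empty (not_lt.2 hbc)]
  have h1 : IntervalIntegrable (fun u => (a - u) ^ r) volume b c := by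
    refine ContinuousOn.intervalIntegrable fun u hu => ?_
    rw [uIcc_of_le hcb.le] at hu
    have : a - u ≠ 0 := by linarith [hu.2]
    exact ((continuousAt_const.sub continuousAt_id).rpow_const (Or.inl this)).continuousWithinAt
  rw [lintegral_Ioo_ofReal hcb.le h1 fun u hu => Real.rpow_nonneg (by linarith [hu.2]) _,
    intervalIntegral.integral_comp_sub_left (fun v => v ^ r) a]
  exact ENNReal.ofReal_le_ofReal
    (integral_rpow_le_of_lt_neg_one hr (by linarith) (by linarith))

theorem lintegral_Ioo_exp_le {l a b : ℝ} (hl : 0 < l) (hab : a ≤ b) :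
    ∫⁻ u in Ioo a b, ENNReal.ofReal (Real.exp (l * u))
      ≤ ENNReal.ofReal (Real.exp (l * b) * min (1 / l) (b - a)) := by
  rw [lintegral_Ioo_ofReal hab
    ((by fun_prop : Continuous fun u => Real.exp (l * u)).intervalIntegrable _ _)
    fun u _ => (Real.exp_pos _).le]
  refine ENNReal.ofReal_le_ofReal ?_
  rw [mul_min_of_nonneg _ _ (Real.exp_pos _).le]
  refine le_min ?_ ?_
  · rw [intervalIntegral.integral_comp_mul_left (fun v => Real.exp v) hl.ne', integral_exp,
      smul_eq_mul, mul_one_div, inv_mul_eq_div]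
    exact div_le_div_of_nonneg_right (by linarith [Real.exp_pos (l * a)]) hl.le
  · have h : ∫ u in a..b, Real.exp (l * u) ≤ ∫ u in a..b, Real.exp (l * b) := by
      refine intervalIntegral.integral_mono_on hab
        ((by fun_prop : Continuous fun u => Real.exp (l * u)).intervalIntegrable _ _)
        intervalIntegrable_const fun u hu => ?_
      exact Real.exp_le_exp.2 (mul_le_mul_of_nonneg_left hu.2 hl.le)
    simpa [mul_comm] using h

/-- The kernel estimate behind the exponentially weighted norms: the weight `e^{λu}` turns the
singularities `(u-s)^{-α}` and `(t-u)^{-α}` into the gain `min (1/λ) (t-s) ^ (1-α)`. -/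
theorem lintegral_exp_mul_kernel_le {α l s t : ℝ} (hα0 : 0 < α) (hα1 : α < 1) (hl : 0 < l)
    (hst : s < t) :
    ∫⁻ u in Ioo s t, ENNReal.ofReal (Real.exp (l * u) * ((u - s) ^ (-α) + (t - u) ^ (-α)))
      ≤ ENNReal.ofReal ((2 / (1 - α) + 2) * (Real.exp (l * t) * min (1 / l) (t - s) ^ (1 - α))) := by
  set w := min (1 / l) (t - s) with hw
  have hw0 : 0 < w := lt_min (by positivity) (by linarith)
  have hwt : w ≤ t - s := min_le_right _ _
  have hE := Real.exp_pos (l * t)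
  -- Near the singular endpoint the weight is bounded by its maximum, at distance at least `w`
  -- the power is bounded by `w ^ (-α)`.
  have key : ∀ u ∈ Ioo s t,
      ENNReal.ofReal (Real.exp (l * u) * ((u - s) ^ (-α) + (t - u) ^ (-α))) ≤
      ((Ioo s (s + w)).indicator
          (fun u => ENNReal.ofReal (Real.exp (l * t)) * ENNReal.ofReal ((u - s) ^ (-α))) u +
        (Ioo (t - w) t).indicator
          (fun u => ENNReal.ofReal (Real.exp (l * t)) * ENNReal.ofReal ((t - u) ^ (-α))) u) +
        ENNReal.ofReal (2 * w ^ (-α)) * ENNReal.ofReal (Real.exp (l * u)) := by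
    intro u hu
    have hexp : Real.exp (l * u) ≤ Real.exp (l * t) :=
      Real.exp_le_exp.2 (mul_le_mul_of_nonneg_left hu.2.le hl.le)
    have hp1 : 0 ≤ (u - s) ^ (-α) := Real.rpow_nonneg (by linarith [hu.1]) _
    have hp2 : 0 ≤ (t - u) ^ (-α) := Real.rpow_nonneg (by linarith [hu.2]) _
    have hpw : 0 ≤ w ^ (-α) := Real.rpow_nonneg hw0.le _
    have A : ∀ (p : ℝ) (S : Set ℝ), 0 < p → (u ∉ S → w ≤ p) →
        ENNReal.ofReal (Real.exp (l * u) * p ^ (-α)) ≤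
        S.indicator (fun _ => ENNReal.ofReal (Real.exp (l * t)) * ENNReal.ofReal (p ^ (-α))) u +
          ENNReal.ofReal (w ^ (-α)) * ENNReal.ofReal (Real.exp (l * u)) := by
      intro p S hp hS
      by_cases h : u ∈ S
      · rw [indicator_of_mem h, ← ENNReal.ofReal_mul hE.le]
        exact le_add_right (ENNReal.ofReal_le_ofReal
          (mul_le_mul_of_nonneg_right hexp (Real.rpow_nonneg hp.le _)))
      · rw [indicator_of_notMem h, zero_add, ← ENNReal.ofReal_mul hpw, mul_comm]
        exact ENNReal.ofReal_le_ofReal (mul_le_mul_of_nonneg_right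
          (Real.rpow_le_rpow_of_nonpos hw0 (hS h) (by linarith)) (Real.exp_pos _).le)
    have h1 := A (u - s) (Ioo s (s + w)) (by linarith [hu.1])
      fun h => by
        by_contra hc
        exact h ⟨hu.1, by linarith⟩
    have h2 := A (t - u) (Ioo (t - w) t) (by linarith [hu.2])
      fun h => by
        by_contra hc
        exact h ⟨by linarith, hu.2⟩
    rw [mul_add, ENNReal.ofReal_add (by positivity) (by positivity)]
    refine (add_le_add h1 h2).trans (le_of_eq ?_)
    rw [two_mul, ENNReal.ofReal_add hpw hpw]
    simp only [indicator]
    ring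
  refine (setLIntegral_mono' measurableSet_Ioo key).trans ?_
  rw [lintegral_add_right _ (by fun_prop), lintegral_add_right _ (by
      refine Measurable.indicator ?_ measurableSet_Ioo
      fun_prop),
    setLIntegral_indicator measurableSet_Ioo, setLIntegral_indicator measurableSet_Ioo,
    lintegral_const_mul _ (by fun_prop), lintegral_const_mul _ (by fun_prop),
    lintegral_const_mul _ (by fun_prop)]
  have i1 : ∫⁻ u in Ioo s (s + w) ∩ Ioo s t, ENNReal.ofReal ((u - s) ^ (-α))
      ≤ ENNReal.ofReal (w ^ (1 - α) / (1 - α)) := by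
    refine (lintegral_mono_set inter_subset_left).trans (le_of_eq ?_)
    rw [lintegral_Ioo_sub_left_rpow (by linarith) (by linarith)]
    congr 2
    · congr 1 <;> ring
    · ring
  have i2 : ∫⁻ u in Ioo (t - w) t ∩ Ioo s t, ENNReal.ofReal ((t - u) ^ (-α))
      ≤ ENNReal.ofReal (w ^ (1 - α) / (1 - α)) := by
    refine (lintegral_mono_set inter_subset_left).trans (le_of_eq ?_)
    rw [lintegral_Ioo_sub_right_rpow (by linarith) (by linarith)]
    congr 2
    · congr 1 <;> ring
    · ring
  have i3 := lintegral_Ioo_exp_le hl hst.le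
  have h1α : 0 < 1 - α := by linarith
  have hwk : w ^ (-α) * w = w ^ (1 - α) := by
    rw [sub_eq_neg_add, Real.rpow_add hw0, Real.rpow_one]
  calc _ ≤ (ENNReal.ofReal (Real.exp (l * t)) * ENNReal.ofReal (w ^ (1 - α) / (1 - α)) +
        ENNReal.ofReal (Real.exp (l * t)) * ENNReal.ofReal (w ^ (1 - α) / (1 - α))) +
        ENNReal.ofReal (2 * w ^ (-α)) * ENNReal.ofReal (Real.exp (l * t) * w) := by gcongr
    _ = _ := by
      rw [← ENNReal.ofReal_mul hE.le, ← ENNReal.ofReal_mul (by positivity),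
        ← ENNReal.ofReal_add (by positivity) (by positivity),
        ← ENNReal.ofReal_add (by positivity) (by positivity), ← hwk]
      congr 1
      field_simp
      ring

/-- The singular integral of the gain `min (1/λ) (t-s) ^ (1-α)`,
convergent because `α < 1/2`. -/
theorem lintegral_rpow_mul_min_le {α l t : ℝ} (hα0 : 0 < α) (hα1 : α < 1 / 2) (hl : 0 < l) :
    ∫⁻ s in Ioo 0 t, ENNReal.ofReal (min (1 / l) (t - s) ^ (1 - α) / (t - s) ^ (α + 1))
      ≤ ENNReal.ofReal ((1 / (1 - 2 * α) + 1 / α) * l ^ (2 * α - 1)) := by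
  have hp : ∀ s < t, 0 < t - s := fun s hs => by linarith
  have hl' : 0 < 1 / l := by positivity
  have sub : Ioo 0 t ⊆ Ioo 0 (t - 1 / l) ∪ Ico (t - 1 / l) t := by
    intro s hs
    rcases lt_or_ge s (t - 1 / l) with h | h
    · exact Or.inl ⟨hs.1, h⟩
    · exact Or.inr ⟨h, hs.2⟩
  have e1 : (1 / l) ^ (1 - 2 * α) = l ^ (2 * α - 1) := by
    rw [one_div, Real.inv_rpow hl.le, ← Real.rpow_neg hl.le]; congr 1; ring
  have i1 : ∫⁻ s in Ioo 0 (t - 1 / l),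
      ENNReal.ofReal (min (1 / l) (t - s) ^ (1 - α) / (t - s) ^ (α + 1))
      ≤ ENNReal.ofReal (1 / α * l ^ (2 * α - 1)) := by
    calc _ ≤ ∫⁻ s in Ioo 0 (t - 1 / l), ENNReal.ofReal ((1 / l) ^ (1 - α)) *
          ENNReal.ofReal ((t - s) ^ (-α - 1)) := by
          refine setLIntegral_mono' measurableSet_Ioo fun s hs => ?_
          have h0 : 0 < t - s := by linarith [hs.2]
          rw [← ENNReal.ofReal_mul (by positivity), div_eq_mul_inv, ← Real.rpow_neg h0.le]
          refine ENNReal.ofReal_le_ofReal ?_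
          rw [show -(α + 1) = -α - 1 by ring]
          refine mul_le_mul_of_nonneg_right ?_ (by positivity)
          exact Real.rpow_le_rpow (le_min hl'.le h0.le) (min_le_left _ _) (by linarith)
      _ = ENNReal.ofReal ((1 / l) ^ (1 - α)) * _ := lintegral_const_mul _ (by fun_prop)
      _ ≤ ENNReal.ofReal ((1 / l) ^ (1 - α)) *
          ENNReal.ofReal ((t - (t - 1 / l)) ^ (-α - 1 + 1) / -(-α - 1 + 1)) := by
          gcongr
          exact lintegral_Ioo_sub_right_rpow_le (by linarith) (by linarith)
      _ = _ := by
          rw [← ENNReal.ofReal_mul (by positivity)]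
          congr 1
          rw [← e1, show 1 - 2 * α = (1 - α) + (-α) by ring, Real.rpow_add hl']
          rw [show t - (t - 1 / l) = 1 / l by ring, show -α - 1 + 1 = -α by ring, neg_neg]
          ring
  have i2 : ∫⁻ s in Ioo (t - 1 / l) t,
      ENNReal.ofReal (min (1 / l) (t - s) ^ (1 - α) / (t - s) ^ (α + 1))
      ≤ ENNReal.ofReal (1 / (1 - 2 * α) * l ^ (2 * α - 1)) := by
    calc _ ≤ ∫⁻ s in Ioo (t - 1 / l) t, ENNReal.ofReal ((t - s) ^ (-2 * α)) := by
          refine setLIntegral_mono' measurableSet_Ioo fun s hs => ?_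
          have h0 : 0 < t - s := by linarith [hs.2]
          refine ENNReal.ofReal_le_ofReal ?_
          rw [div_le_iff₀ (by positivity), ← Real.rpow_add h0,
            show -2 * α + (α + 1) = 1 - α by ring]
          exact Real.rpow_le_rpow (le_min hl'.le h0.le) (min_le_right _ _) (by linarith)
      _ = _ := by
          rw [lintegral_Ioo_sub_right_rpow (by linarith) (by linarith)]
          congr 1
          rw [← e1, show t - (t - 1 / l) = 1 / l by ring, show -2 * α + 1 = 1 - 2 * α by ring]
          ring
  refine (lintegral_mono_set sub).trans ((lintegral_union_le _ _ _).trans ?_)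
  rw [setLIntegral_congr (Ioo_ae_eq_Ico (a := t - 1 / l) (b := t)).symm, add_mul, add_comm,
    ENNReal.ofReal_add (by
      have : 0 < 1 - 2 * α := by linarith
      positivity) (by positivity)]
  exact add_le_add i2 i1

/-! ### The left-sided Weyl derivative -/

/-- The pointwise majorant `|F(s)| / s^α + ∫_0^s |F(s) - F(y)| / (s - y)^{α+1} dy` of the
left-sided Weyl derivative of `F` at `s`, up to the factor `1 / Γ(1 - α)`. -/
def weylMajorant {E : Type*} [NormedAddCommGroup E] (α : ℝ) (F : ℝ → E) (s : ℝ) : ENNReal :=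
  ENNReal.ofReal (‖F s‖ / s ^ α) +
    ∫⁻ y in Ioo (0 : ℝ) s, ENNReal.ofReal (‖F s - F y‖ / (s - y) ^ (α + 1))

/-- The `W^{α,1}`-type functional `∫_0^T weylMajorant α F`, with values in `[0, ∞]`. -/
def weylMass {E : Type*} [NormedAddCommGroup E] (T α : ℝ) (F : ℝ → E) : ENNReal :=
  ∫⁻ s in Ioo (0 : ℝ) T, weylMajorant α F s

section

variable {E : Type*} [NormedAddCommGroup E]

theorem weylMajorant_mono {E' : Type*} [NormedAddCommGroup E'] {α s : ℝ} (hs : 0 < s)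
    {F : ℝ → E} {G : ℝ → E'} (h : ∀ y, ‖F y‖ ≤ ‖G y‖) (h' : ∀ y z, ‖F y - F z‖ ≤ ‖G y - G z‖) :
    weylMajorant α F s ≤ weylMajorant α G s := by
  refine add_le_add (ENNReal.ofReal_le_ofReal ?_)
    (setLIntegral_mono' measurableSet_Ioo fun y hy => ENNReal.ofReal_le_ofReal ?_)
  · exact div_le_div_of_nonneg_right (h s) (by positivity)
  · exact div_le_div_of_nonneg_right (h' s y) (Real.rpow_nonneg (by linarith [hy.2]) _)

theorem weylMass_mono {E' : Type*} [NormedAddCommGroup E'] {T α : ℝ}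
    {F : ℝ → E} {G : ℝ → E'} (h : ∀ y, ‖F y‖ ≤ ‖G y‖) (h' : ∀ y z, ‖F y - F z‖ ≤ ‖G y - G z‖) :
    weylMass T α F ≤ weylMass T α G :=
  setLIntegral_mono' measurableSet_Ioo fun _ hs => weylMajorant_mono hs.1 h h'

theorem aemeasurable_weylKernel {α : ℝ} {F : ℝ → E} (hF : AEStronglyMeasurable F volume) :
    AEMeasurable (fun p : ℝ × ℝ => (Ioo (0 : ℝ) p.1).indicator
      (fun y => ENNReal.ofReal (‖F p.1 - F y‖ / (p.1 - y) ^ (α + 1))) p.2)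
      (volume.prod volume) := by
  have h1 : AEStronglyMeasurable (fun p : ℝ × ℝ => F p.1) (volume.prod volume) := hF.comp_fst
  have h2 : AEStronglyMeasurable (fun p : ℝ × ℝ => F p.2) (volume.prod volume) := hF.comp_snd
  have hS : MeasurableSet {p : ℝ × ℝ | 0 < p.2 ∧ p.2 < p.1} :=
    (measurableSet_lt measurable_const measurable_snd).inter
      (measurableSet_lt measurable_snd measurable_fst)
  have h3 : AEMeasurable (fun p : ℝ × ℝ =>
      ENNReal.ofReal (‖F p.1 - F p.2‖ / (p.1 - p.2) ^ (α + 1))) (volume.prod volume) :=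
    (((h1.sub h2).norm.aemeasurable).div
      (((measurable_fst.sub measurable_snd).pow_const _).aemeasurable)).ennreal_ofReal
  refine (h3.indicator hS).congr (Filter.Eventually.of_forall fun p => ?_)
  simp only [indicator, mem_ofPred_eq, mem_Ioo]

theorem aemeasurable_lintegral_weylKernel {α : ℝ} {F : ℝ → E}
    (hF : AEStronglyMeasurable F volume) :
    AEMeasurable (fun s => ∫⁻ y in Ioo (0 : ℝ) s,
      ENNReal.ofReal (‖F s - F y‖ / (s - y) ^ (α + 1))) volume := by
  refine (aemeasurable_weylKernel (α := α) hF).lintegral_prod_right'.congr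
    (Filter.Eventually.of_forall fun s => ?_)
  exact lintegral_indicator measurableSet_Ioo _

theorem aemeasurable_weylMajorant {α : ℝ} {F : ℝ → E} (hF : AEStronglyMeasurable F volume) :
    AEMeasurable (weylMajorant α F) volume :=
  ((hF.norm.aemeasurable.div (measurable_id.pow_const α).aemeasurable).ennreal_ofReal).add
    (aemeasurable_lintegral_weylKernel hF)

theorem weylMajorant_add_le {α s : ℝ} (hs : 0 < s) {F G : ℝ → E}
    (hF : AEStronglyMeasurable F volume) :
    weylMajorant α (F + G) s ≤ weylMajorant α F s + weylMajorant α G s := by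
  unfold weylMajorant
  have hm : AEMeasurable (fun y => ENNReal.ofReal (‖F s - F y‖ / (s - y) ^ (α + 1)))
      (volume.restrict (Ioo 0 s)) :=
    ((((aestronglyMeasurable_const.sub hF).norm.aemeasurable).div
      ((measurable_const.sub measurable_id).pow_const _).aemeasurable).ennreal_ofReal).restrict
  rw [add_add_add_comm, ← lintegral_add_left' hm]
  refine add_le_add ?_ (setLIntegral_mono' measurableSet_Ioo fun y hy => ?_)
  · rw [← ENNReal.ofReal_add (by positivity) (by positivity), ← add_div]
    exact ENNReal.ofReal_le_ofReal (div_le_div_of_nonneg_right (norm_add_le _ _) (by positivity))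
  · have : 0 ≤ (s - y) ^ (α + 1) := Real.rpow_nonneg (by linarith [hy.2]) _
    rw [← ENNReal.ofReal_add (by positivity) (by positivity), ← add_div]
    refine ENNReal.ofReal_le_ofReal (div_le_div_of_nonneg_right ?_ this)
    rw [Pi.add_apply, Pi.add_apply, add_sub_add_comm]
    exact norm_add_le _ _

theorem weylMass_add_le {T α : ℝ} {F G : ℝ → E} (hF : AEStronglyMeasurable F volume) :
    weylMass T α (F + G) ≤ weylMass T α F + weylMass T α G := by
  unfold weylMass
  rw [← lintegral_add_left' (aemeasurable_weylMajorant hF).restrict]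
  exact setLIntegral_mono' measurableSet_Ioo fun s hs => weylMajorant_add_le hs.1 hF

/-- The functional `weylMass` of a function cut off to `[a, t)`. The cut-off contributes the kernel
`(u-a)^{-α}` at its left end and, from the Weyl derivative beyond `t`, the kernel `(t-u)^{-α}` at
its right end, so that no integration by parts is needed to restrict integrals to `[a, t)`. -/
theorem weylMass_indicator_le {T α a t : ℝ} (hα0 : 0 < α) (ha : 0 ≤ a) {f : ℝ → E}
    (hf : AEStronglyMeasurable f (volume.restrict (Ico a t))) :
    weylMass T α ((Ico a t).indicator f) ≤
      ENNReal.ofReal (1 + 1 / α) *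
        (∫⁻ u in Ioo a t, ENNReal.ofReal (‖f u‖ * ((u - a) ^ (-α) + (t - u) ^ (-α)))) +
      ∫⁻ u in Ioo a t, ∫⁻ y in Ioo a u, ENNReal.ofReal (‖f u - f y‖ / (u - y) ^ (α + 1)) := by
  set F := (Ico a t).indicator f with hFdef
  have hF : AEStronglyMeasurable F volume :=
    (aestronglyMeasurable_indicator_iff measurableSet_Ico).2 hf
  have hf' : AEMeasurable (fun u => ‖f u‖) (volume.restrict (Ioo a t)) :=
    (hf.mono_measure (Measure.restrict_mono Ioo_subset_Ico_self le_rfl)).norm.aemeasurable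
  have hFin : ∀ u ∈ Ioo a t, F u = f u := fun u hu =>
    indicator_of_mem (Ioo_subset_Ico_self hu) f
  have hFout : ∀ u, u ∉ Ico a t → F u = 0 := fun u hu => indicator_of_notMem hu f
  have sub : Ioo 0 T ⊆ Ioo 0 a ∪ (Ico a t ∪ Ioo 0 T ∩ Ici t) := by
    intro s hs
    rcases lt_or_ge s a with h | h
    · exact Or.inl ⟨hs.1, h⟩
    rcases lt_or_ge s t with h' | h'
    · exact Or.inr (Or.inl ⟨h, h'⟩)
    · exact Or.inr (Or.inr ⟨hs, h'⟩)
  -- Before `a` the function vanishes identically.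
  have i1 : ∫⁻ s in Ioo 0 a, weylMajorant α F s ≤ 0 := by
    refine (setLIntegral_mono' (g := fun _ => 0) measurableSet_Ioo fun s hs => ?_).trans
      (by simp)
    have h0 : F s = 0 := hFout s fun h => absurd h.1 (not_le.2 hs.2)
    unfold weylMajorant
    rw [h0, setLIntegral_congr_fun (g := fun _ => 0) measurableSet_Ioo fun y hy => by
      have : F y = 0 := hFout y fun h => absurd h.1 (not_le.2 (hy.2.trans hs.2))
      simp [this]]
    simp
  -- On `(a, t)` the jump at `a` adds `f(s) ∫_0^a (s-y)^{-α-1} dy`.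
  have i2 : ∫⁻ s in Ioo a t, weylMajorant α F s ≤
      (∫⁻ s in Ioo a t, ENNReal.ofReal (1 + 1 / α) * ENNReal.ofReal (‖f s‖ * (s - a) ^ (-α))) +
      ∫⁻ s in Ioo a t, ∫⁻ y in Ioo a s, ENNReal.ofReal (‖f s - f y‖ / (s - y) ^ (α + 1)) := by
    rw [← lintegral_add_left' (by
      exact ((hf'.mul ((measurable_id.sub measurable_const).pow_const _).aemeasurable
        ).ennreal_ofReal).const_mul _)]
    refine setLIntegral_mono' measurableSet_Ioo fun s hs => ?_
    have hsa : 0 < s - a := by linarith [hs.1]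
    have hs0 : 0 < s := by linarith [hs.1]
    unfold weylMajorant
    rw [hFin s hs]
    have j1 : ENNReal.ofReal (‖f s‖ / s ^ α) ≤ ENNReal.ofReal (‖f s‖ * (s - a) ^ (-α)) := by
      refine ENNReal.ofReal_le_ofReal ?_
      rw [div_eq_mul_inv, ← Real.rpow_neg hs0.le]
      exact mul_le_mul_of_nonneg_left
        (Real.rpow_le_rpow_of_nonpos hsa (by linarith) (by linarith)) (norm_nonneg _)
    have j2 : ∫⁻ y in Ioo 0 a, ENNReal.ofReal (‖f s - F y‖ / (s - y) ^ (α + 1)) ≤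
        ENNReal.ofReal (1 / α) * ENNReal.ofReal (‖f s‖ * (s - a) ^ (-α)) := by
      calc _ ≤ ∫⁻ y in Ioo 0 a, ENNReal.ofReal ‖f s‖ * ENNReal.ofReal ((s - y) ^ (-α - 1)) := by
            refine setLIntegral_mono' measurableSet_Ioo fun y hy => ?_
            have h0 : F y = 0 := hFout y fun h => absurd h.1 (not_le.2 hy.2)
            have h1 : 0 < s - y := by linarith [hy.2]
            rw [h0, sub_zero, ← ENNReal.ofReal_mul (norm_nonneg _), div_eq_mul_inv,
              ← Real.rpow_neg h1.le, show -(α + 1) = -α - 1 by ring]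
        _ = ENNReal.ofReal ‖f s‖ * _ := lintegral_const_mul _ (by fun_prop)
        _ ≤ ENNReal.ofReal ‖f s‖ *
            ENNReal.ofReal ((s - a) ^ (-α - 1 + 1) / -(-α - 1 + 1)) := by
            gcongr
            exact lintegral_Ioo_sub_right_rpow_le (by linarith) hs.1
        _ = _ := by
            rw [← ENNReal.ofReal_mul (norm_nonneg _), ← ENNReal.ofReal_mul (by positivity),
              show -α - 1 + 1 = -α by ring, neg_neg]
            congr 1
            ring
    have j3 : ∫⁻ y in Ioo 0 s, ENNReal.ofReal (‖f s - F y‖ / (s - y) ^ (α + 1)) ≤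
        ENNReal.ofReal (1 / α) * ENNReal.ofReal (‖f s‖ * (s - a) ^ (-α)) +
        ∫⁻ y in Ioo a s, ENNReal.ofReal (‖f s - f y‖ / (s - y) ^ (α + 1)) := by
      have hsub : Ioo 0 s ⊆ Ioo 0 a ∪ Ico a s := fun y hy => by
        rcases lt_or_ge y a with h | h
        · exact Or.inl ⟨hy.1, h⟩
        · exact Or.inr ⟨h, hy.2⟩
      refine (lintegral_mono_set hsub).trans ((lintegral_union_le _ _ _).trans
        (add_le_add j2 ?_))
      rw [setLIntegral_congr (Ioo_ae_eq_Ico (a := a) (b := s)).symm]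
      refine setLIntegral_mono' measurableSet_Ioo fun y hy => ?_
      rw [hFin y ⟨hy.1, hy.2.trans hs.2⟩]
    refine (add_le_add j1 j3).trans (le_of_eq ?_)
    rw [← add_assoc, ENNReal.ofReal_add zero_le_one (by positivity), ENNReal.ofReal_one, add_mul,
      one_mul]
  -- Beyond `t` only `∫_a^t f(y) (s-y)^{-α-1} dy` is left, to which Tonelli's theorem applies.
  have i3 : ∫⁻ s in Ioo 0 T ∩ Ici t, weylMajorant α F s ≤
      ∫⁻ u in Ioo a t, ENNReal.ofReal (1 + 1 / α) *
        ENNReal.ofReal (‖f u‖ * (t - u) ^ (-α)) := by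
    have hmeas : AEMeasurable (fun p : ℝ × ℝ =>
        ENNReal.ofReal ‖f p.2‖ * ENNReal.ofReal ((p.1 - p.2) ^ (-α - 1)))
        ((volume.restrict (Ioo t T)).prod (volume.restrict (Ioo a t))) := by
      have := hf'.comp_snd (μ := volume.restrict (Ioo t T))
      refine this.ennreal_ofReal.mul ?_
      exact ((measurable_fst.sub measurable_snd).pow_const _).ennreal_ofReal.aemeasurable
    calc _ ≤ ∫⁻ s in Ico t T, weylMajorant α F s :=
          lintegral_mono_set fun s hs => ⟨hs.2, hs.1.2⟩
      _ = ∫⁻ s in Ioo t T, weylMajorant α F s :=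
          setLIntegral_congr (Ioo_ae_eq_Ico (a := t) (b := T)).symm
      _ ≤ ∫⁻ s in Ioo t T, ∫⁻ y in Ioo a t,
            ENNReal.ofReal ‖f y‖ * ENNReal.ofReal ((s - y) ^ (-α - 1)) := by
          refine setLIntegral_mono' measurableSet_Ioo fun s hs => ?_
          have h0 : F s = 0 := hFout s fun h => absurd h.2 (not_lt.2 hs.1.le)
          unfold weylMajorant
          rw [h0, norm_zero, zero_div, ENNReal.ofReal_zero, zero_add]
          calc _ ≤ ∫⁻ y in Ico a t,
                ENNReal.ofReal ‖f y‖ * ENNReal.ofReal ((s - y) ^ (-α - 1)) := by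
                rw [← lintegral_indicator measurableSet_Ioo,
                  ← lintegral_indicator measurableSet_Ico]
                refine lintegral_mono fun y => ?_
                by_cases hy : y ∈ Ico a t
                · rw [indicator_of_mem hy]
                  refine (indicator_le_self _ _ y).trans (le_of_eq ?_)
                  have h1 : 0 < s - y := by linarith [hy.2, hs.1]
                  rw [hFdef, indicator_of_mem hy, zero_sub, norm_neg,
                    ← ENNReal.ofReal_mul (norm_nonneg _), div_eq_mul_inv, ← Real.rpow_neg h1.le,
                    show -(α + 1) = -α - 1 by ring]
                · simp [hFdef, hy, indicator]
            _ = _ := setLIntegral_congr (Ioo_ae_eq_Ico (a := a) (b := t)).symm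
      _ = ∫⁻ y in Ioo a t, ∫⁻ s in Ioo t T,
            ENNReal.ofReal ‖f y‖ * ENNReal.ofReal ((s - y) ^ (-α - 1)) :=
          lintegral_lintegral_swap hmeas
      _ ≤ _ := by
          refine setLIntegral_mono' measurableSet_Ioo fun y hy => ?_
          have hty : 0 < t - y := by linarith [hy.2]
          rw [lintegral_const_mul _ (by fun_prop)]
          calc _ ≤ ENNReal.ofReal ‖f y‖ *
                ENNReal.ofReal ((t - y) ^ (-α - 1 + 1) / -(-α - 1 + 1)) := by
                gcongr
                exact lintegral_Ioo_sub_left_rpow_le (by linarith) hy.2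
            _ ≤ _ := by
                rw [← ENNReal.ofReal_mul (norm_nonneg _), ← ENNReal.ofReal_mul (by positivity),
                  show -α - 1 + 1 = -α by ring, neg_neg]
                refine ENNReal.ofReal_le_ofReal ?_
                rw [← mul_div_assoc, div_eq_mul_one_div, mul_comm]
                exact mul_le_mul_of_nonneg_right (by linarith) (by positivity)
  have tot : weylMass T α F ≤ 0 + ((∫⁻ s in Ioo a t, weylMajorant α F s) +
      ∫⁻ s in Ioo 0 T ∩ Ici t, weylMajorant α F s) := by
    refine (lintegral_mono_set sub).trans ((lintegral_union_le _ _ _).trans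
      (add_le_add i1 ?_))
    rw [setLIntegral_congr (Ioo_ae_eq_Ico (a := a) (b := t))]
    exact lintegral_union_le _ _ _
  refine tot.trans ?_
  rw [zero_add]
  refine (add_le_add i2 i3).trans (le_of_eq ?_)
  rw [add_right_comm]
  congr 1
  rw [lintegral_const_mul'' _ (by
      exact (hf'.mul ((measurable_id.sub measurable_const).pow_const _).aemeasurable
        ).ennreal_ofReal), lintegral_const_mul'' _ (by
      exact (hf'.mul ((measurable_const.sub measurable_id).pow_const _).aemeasurable
        ).ennreal_ofReal), ← mul_add, ← lintegral_add_left' (by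
      exact (hf'.mul ((measurable_id.sub measurable_const).pow_const _).aemeasurable
        ).ennreal_ofReal)]
  congr 1
  refine setLIntegral_congr_fun measurableSet_Ioo fun u hu => ?_
  have h1 : 0 ≤ (u - a) ^ (-α) := Real.rpow_nonneg (by linarith [hu.1]) _
  have h2 : 0 ≤ (t - u) ^ (-α) := Real.rpow_nonneg (by linarith [hu.2]) _
  rw [mul_add, ENNReal.ofReal_add (by positivity) (by positivity)]

end

/-! ### The generalized Stieltjes integral -/

theorem enorm_weylLeft_le {α s : ℝ} (hα0 : 0 < α) (hα1 : α < 1) (hs : 0 < s) (F : ℝ → ℝ) :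
    ‖weylLeft α F s‖ₑ ≤ ENNReal.ofReal (1 / Real.Gamma (1 - α)) * weylMajorant α F s := by
  have hΓ : 0 < Real.Gamma (1 - α) := Real.Gamma_pos_of_pos (by linarith)
  unfold weylLeft weylMajorant
  rw [enorm_mul, Real.enorm_of_nonneg (by positivity)]
  gcongr
  refine (enorm_add_le _ _).trans (add_le_add ?_ ?_)
  · rw [← ofReal_norm, norm_div, Real.norm_of_nonneg (by positivity : 0 ≤ s ^ α)]
  · rw [enorm_mul, Real.enorm_of_nonneg hα0.le]
    have h1 : ‖∫ y in (0 : ℝ)..s, (F s - F y) / (s - y) ^ (α + 1)‖ₑ ≤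
        ∫⁻ y in Ioo (0 : ℝ) s, ENNReal.ofReal (‖F s - F y‖ / (s - y) ^ (α + 1)) := by
      rw [intervalIntegral.integral_of_le hs.le, integral_Ioc_eq_integral_Ioo]
      refine (enorm_integral_le_lintegral_enorm _).trans (le_of_eq ?_)
      refine setLIntegral_congr_fun measurableSet_Ioo fun y hy => ?_
      have : 0 ≤ (s - y) ^ (α + 1) := Real.rpow_nonneg (by linarith [hy.2]) _
      rw [← ofReal_norm, norm_div, Real.norm_of_nonneg this]
    calc _ ≤ 1 * _ := mul_le_mul' (by
          rw [← ENNReal.ofReal_one]; exact ENNReal.ofReal_le_ofReal hα1.le) h1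
      _ = _ := one_mul _

theorem aestronglyMeasurable_weylLeft {T α : ℝ} {F : ℝ → ℝ}
    (hF : AEStronglyMeasurable F volume) :
    AEStronglyMeasurable (weylLeft α F) (volume.restrict (Ioo 0 T)) := by
  have h1 : AEStronglyMeasurable (fun p : ℝ × ℝ => F p.1) (volume.prod volume) := hF.comp_fst
  have h2 : AEStronglyMeasurable (fun p : ℝ × ℝ => F p.2) (volume.prod volume) := hF.comp_snd
  have hS : MeasurableSet {p : ℝ × ℝ | 0 < p.2 ∧ p.2 ≤ p.1} :=
    (measurableSet_lt measurable_const measurable_snd).inter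
      (measurableSet_le measurable_snd measurable_fst)
  have h3 : AEStronglyMeasurable ({p : ℝ × ℝ | 0 < p.2 ∧ p.2 ≤ p.1}.indicator
      (fun p : ℝ × ℝ => (F p.1 - F p.2) / (p.1 - p.2) ^ (α + 1))) (volume.prod volume) :=
    (((h1.sub h2).aemeasurable.div
      (((measurable_fst.sub measurable_snd).pow_const _).aemeasurable)
      ).aestronglyMeasurable).indicator hS
  have h4 : AEStronglyMeasurable (fun s => F s / s ^ α) (volume.restrict (Ioo 0 T)) :=
    ((hF.aemeasurable.div (measurable_id.pow_const α).aemeasurable).aestronglyMeasurable).restrict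
  refine ((h4.add (h3.integral_prod_right'.restrict.const_mul α)).const_mul
    (1 / Real.Gamma (1 - α))).congr
    ((ae_restrict_iff' measurableSet_Ioo).2 (Filter.Eventually.of_forall fun s hs => ?_))
  simp only [Pi.add_apply, weylLeft]
  rw [intervalIntegral.integral_of_le hs.1.le, ← integral_indicator measurableSet_Ioc]
  rfl

theorem integrableOn_weylLeft_mul {T α c : ℝ} (hα0 : 0 < α) (hα1 : α < 1) {F w : ℝ → ℝ}
    (hF : AEStronglyMeasurable F volume) (hFT : weylMass T α F < ⊤)
    (hw : AEStronglyMeasurable w (volume.restrict (Ioo 0 T)))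
    (hwc : ∀ s ∈ Ioo 0 T, ‖w s‖ ≤ c) :
    IntegrableOn (fun s => weylLeft α F s * w s) (Ioo 0 T) := by
  have h : IntegrableOn (weylLeft α F) (Ioo 0 T) := by
    refine ⟨aestronglyMeasurable_weylLeft hF, ?_⟩
    refine lt_of_le_of_lt (setLIntegral_mono' measurableSet_Ioo fun s hs =>
      enorm_weylLeft_le hα0 hα1 hs.1 F) ?_
    rw [lintegral_const_mul'' _ (aemeasurable_weylMajorant hF).restrict]
    exact ENNReal.mul_lt_top ENNReal.ofReal_lt_top hFT
  exact h.mul_bdd hw ((ae_restrict_iff' measurableSet_Ioo).2 (Filter.Eventually.of_forall hwc))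

theorem enorm_stieltjes_le {T α c : ℝ} (hT : 0 < T) (hα0 : 0 < α) (hα1 : α < 1) {F g : ℝ → ℝ}
    (hwc : ∀ s ∈ Ioo 0 T, ‖weylRight (1 - α) g T s‖ ≤ Real.Gamma (1 - α) * c) :
    ‖stieltjes T α F g‖ₑ ≤ ENNReal.ofReal c * weylMass T α F := by
  have hΓ : 0 < Real.Gamma (1 - α) := Real.Gamma_pos_of_pos (by linarith)
  unfold stieltjes weylMass
  rw [enorm_neg, intervalIntegral.integral_of_le hT.le, integral_Ioc_eq_integral_Ioo,
    ← lintegral_const_mul' _ _ ENNReal.ofReal_ne_top]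
  refine (enorm_integral_le_lintegral_enorm _).trans
    (setLIntegral_mono' measurableSet_Ioo fun s hs => ?_)
  rw [enorm_mul]
  calc _ ≤ (ENNReal.ofReal (1 / Real.Gamma (1 - α)) * weylMajorant α F s) *
        ENNReal.ofReal (Real.Gamma (1 - α) * c) := by
        gcongr
        · exact enorm_weylLeft_le hα0 hα1 hs.1 F
        · rw [← ofReal_norm]
          exact ENNReal.ofReal_le_ofReal (hwc s hs)
    _ = _ := by
        rw [mul_right_comm, ← ENNReal.ofReal_mul (by positivity)]
        congr 2
        field_simp

theorem weylLeft_sub {α s : ℝ} (hs : 0 < s) {F G : ℝ → ℝ}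
    (hF : AEStronglyMeasurable F volume) (hG : AEStronglyMeasurable G volume)
    (hFs : weylMajorant α F s < ⊤) (hGs : weylMajorant α G s < ⊤) :
    weylLeft α (F - G) s = weylLeft α F s - weylLeft α G s := by
  have key : ∀ H : ℝ → ℝ, AEStronglyMeasurable H volume → weylMajorant α H s < ⊤ →
      IntervalIntegrable (fun y => (H s - H y) / (s - y) ^ (α + 1)) volume 0 s := by
    intro H hH hHs
    rw [intervalIntegrable_iff_integrableOn_Ioo_of_le hs.le]
    refine ⟨((((aestronglyMeasurable_const.sub hH).aemeasurable).div
      ((measurable_const.sub measurable_id).pow_const _).aemeasurable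
      ).aestronglyMeasurable).restrict, ?_⟩
    refine lt_of_le_of_lt (le_of_eq ?_) (ENNReal.add_lt_top.1 hHs).2
    refine setLIntegral_congr_fun measurableSet_Ioo fun y hy => ?_
    have : 0 ≤ (s - y) ^ (α + 1) := Real.rpow_nonneg (by linarith [hy.2]) _
    simp only
    rw [← ofReal_norm, norm_div, Real.norm_of_nonneg this]
  unfold weylLeft
  rw [← mul_sub]
  congr 1
  have : ∫ y in (0 : ℝ)..s, ((F - G) s - (F - G) y) / (s - y) ^ (α + 1) =
      (∫ y in (0 : ℝ)..s, (F s - F y) / (s - y) ^ (α + 1)) -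
      ∫ y in (0 : ℝ)..s, (G s - G y) / (s - y) ^ (α + 1) := by
    rw [← intervalIntegral.integral_sub (key F hF hFs) (key G hG hGs)]
    congr 1
    ext y
    simp only [Pi.sub_apply]
    ring
  rw [this, Pi.sub_apply]
  ring

/-- Linearity of the integral in the integrand, on integrands of finite `weylMass`. -/
theorem stieltjes_sub {T α c : ℝ} (hT : 0 < T) (hα0 : 0 < α) (hα1 : α < 1) {F G g : ℝ → ℝ}
    (hF : AEStronglyMeasurable F volume) (hG : AEStronglyMeasurable G volume)
    (hFT : weylMass T α F < ⊤) (hGT : weylMass T α G < ⊤)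
    (hw : AEStronglyMeasurable (weylRight (1 - α) g T) (volume.restrict (Ioo 0 T)))
    (hwc : ∀ s ∈ Ioo 0 T, ‖weylRight (1 - α) g T s‖ ≤ c) :
    stieltjes T α (F - G) g = stieltjes T α F g - stieltjes T α G g := by
  unfold stieltjes
  have hi : ∀ H : ℝ → ℝ, AEStronglyMeasurable H volume → weylMass T α H < ⊤ →
      IntervalIntegrable (fun s => weylLeft α H s * weylRight (1 - α) g T s) volume 0 T :=
    fun H hH hHT => (intervalIntegrable_iff_integrableOn_Ioo_of_le hT.le).2
      (integrableOn_weylLeft_mul hα0 hα1 hH hHT hw hwc)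
  have hfin : ∀ H : ℝ → ℝ, AEStronglyMeasurable H volume → weylMass T α H < ⊤ →
      ∀ᵐ s ∂(volume.restrict (Ioo 0 T)), weylMajorant α H s < ⊤ := fun H hH hHT =>
    ae_lt_top' (aemeasurable_weylMajorant hH).restrict hHT.ne
  rw [neg_sub_neg, ← neg_inj, neg_neg, neg_sub,
    ← intervalIntegral.integral_sub (hi F hF hFT) (hi G hG hGT),
    intervalIntegral.integral_of_le hT.le, intervalIntegral.integral_of_le hT.le,
    integral_Ioc_eq_integral_Ioo, integral_Ioc_eq_integral_Ioo]
  refine integral_congr_ae ?_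
  filter_upwards [hfin F hF hFT, hfin G hG hGT, ae_restrict_mem measurableSet_Ioo] with s h1 h2 hs
  rw [weylLeft_sub hs.1 hF hG h1 h2, sub_mul]

/-! ### The integrator -/

section

open Filter Topology

variable {E : Type*} [NormedAddCommGroup E] {T α : ℝ} {g : ℝ → E}

theorem MemWT.add_le_norm (hg : MemWT T α g) {s t : ℝ} (hs : 0 < s) (hst : s < t) (ht : t < T) :
    ENNReal.ofReal (‖g t - g s‖ / (t - s) ^ (1 - α)) +
      ∫⁻ y in Ioo s t, ENNReal.ofReal (‖g y - g s‖ / (y - s) ^ (2 - α)) ≤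
      ENNReal.ofReal (normWT T α g).toReal := by
  rw [ENNReal.ofReal_toReal hg.norm_lt_top.ne]
  unfold normWT
  exact le_iSup_of_le s (le_iSup_of_le t (le_iSup_of_le hs (le_iSup_of_le hst
    (le_iSup_of_le ht le_rfl))))

theorem MemWT.norm_sub_le (hg : MemWT T α g) {s t : ℝ} (hs : 0 < s) (hst : s < t) (ht : t < T) :
    ‖g t - g s‖ ≤ (normWT T α g).toReal * (t - s) ^ (1 - α) := by
  have h := le_self_add.trans (hg.add_le_norm hs hst ht)
  rw [ENNReal.ofReal_le_ofReal_iff ENNReal.toReal_nonneg,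
    div_le_iff₀ (Real.rpow_pos_of_pos (by linarith) _)] at h
  exact h

theorem MemWT.holderOnWith (hg : MemWT T α g) (hα : α < 1) :
    HolderOnWith (normWT T α g).toNNReal (1 - α).toNNReal g (Ioo 0 T) := by
  have key : ∀ s ∈ Ioo 0 T, ∀ t ∈ Ioo 0 T, s < t →
      edist (g s) (g t) ≤ (normWT T α g).toNNReal * edist s t ^ ((1 - α).toNNReal : ℝ) := by
    intro s hs t ht hst
    have h := hg.norm_sub_le hs.1 hst ht.2
    rw [Real.coe_toNNReal _ (by linarith), ENNReal.coe_toNNReal hg.norm_lt_top.ne,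
      ← ENNReal.ofReal_toReal hg.norm_lt_top.ne, edist_comm, edist_comm s t, edist_dist, edist_dist,
      ENNReal.ofReal_rpow_of_nonneg dist_nonneg (by linarith),
      ← ENNReal.ofReal_mul ENNReal.toReal_nonneg, dist_eq_norm, Real.dist_eq,
      abs_of_pos (by linarith)]
    exact ENNReal.ofReal_le_ofReal h
  intro s hs t ht
  rcases lt_trichotomy s t with h | h | h
  · exact key s hs t ht h
  · simp [h]
  · rw [edist_comm, edist_comm s]; exact key t ht s hs h

theorem MemWT.continuousOn (hg : MemWT T α g) (hα : α < 1) : ContinuousOn g (Ioo 0 T) :=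
  (hg.holderOnWith hα).continuousOn (by simpa using hα)

theorem MemWT.tendsto_leftLim [CompleteSpace E] (hg : MemWT T α g) (hα : α < 1) (hT : 0 < T) :
    Tendsto g (𝓝[<] T) (𝓝 (Function.leftLim g T)) := by
  have hc : Cauchy (map g (𝓝[<] T)) := by
    refine Cauchy.map_of_le (cauchy_nhds.mono nhdsWithin_le_nhds)
      ((hg.holderOnWith hα).uniformContinuousOn (by simpa using hα)) ?_
    exact le_principal_iff.2 (Ioo_mem_nhdsLT hT)
  obtain ⟨y, hy⟩ := CompleteSpace.complete hc
  rw [leftLim_eq_of_tendsto hy]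
  exact hy

theorem MemWT.leftLim_eq (hg : MemWT T α g) (hα : α < 1) {t : ℝ} (ht : t ∈ Ioo 0 T) :
    Function.leftLim g t = g t :=
  ((hg.continuousOn hα).continuousAt (Ioo_mem_nhds ht.1 ht.2)).continuousWithinAt.leftLim_eq

variable [NormedSpace ℝ E]

/-- The Hölder bound on `g` alone only gives the non-integrable majorant `1 / (y - s)` near `s`;
there the integral part of the norm of `W_T^{1-α,∞}` is used. -/
theorem MemWT.integrable_kernel (hg : MemWT T α g) (hα : α < 1) {s : ℝ} (hs : s ∈ Ioo 0 T) :
    IntervalIntegrable (fun y => ((y - s) ^ (1 - α + 1))⁻¹ • (g s - g y)) volume s T := by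
  have hg' : AEStronglyMeasurable g (volume.restrict (Ioo s T)) :=
    hg.measurable.mono_measure (Measure.restrict_mono
      (fun y (hy : y ∈ Ioo s T) => (⟨(hs.1.trans hy.1).le, hy.2.le⟩ : y ∈ Icc 0 T)) le_rfl)
  rw [intervalIntegrable_iff_integrableOn_Ioo_of_le hs.2.le]
  refine ⟨(((measurable_id.sub measurable_const).pow_const _).inv.aestronglyMeasurable).smul
    (aestronglyMeasurable_const.sub hg'), ?_⟩
  obtain ⟨r, hr⟩ := exists_between hs.2
  have e : ∀ y ∈ Ioo s T, ‖((y - s) ^ (1 - α + 1))⁻¹ • (g s - g y)‖ₑ =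
      ENNReal.ofReal (‖g y - g s‖ / (y - s) ^ (2 - α)) := by
    intro y hy
    have : 0 ≤ (y - s) ^ (1 - α + 1) := Real.rpow_nonneg (by linarith [hy.1]) _
    rw [← ofReal_norm, norm_smul, norm_inv, Real.norm_of_nonneg this, norm_sub_rev,
      show 1 - α + 1 = 2 - α by ring, div_eq_inv_mul]
  change ∫⁻ y in Ioo s T, _ < ⊤
  rw [setLIntegral_congr_fun measurableSet_Ioo e]
  have sub : Ioo s T ⊆ Ioo s r ∪ Ico r T := fun y hy => by
    rcases lt_or_ge y r with h | h
    · exact Or.inl ⟨hy.1, h⟩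
    · exact Or.inr ⟨h, hy.2⟩
  refine lt_of_le_of_lt ((lintegral_mono_set sub).trans (lintegral_union_le _ _ _))
    (ENNReal.add_lt_top.2 ⟨?_, ?_⟩)
  · exact lt_of_le_of_lt (le_add_self.trans (hg.add_le_norm hs.1 hr.1 hr.2))
      ENNReal.ofReal_lt_top
  · refine lt_of_le_of_lt (setLIntegral_mono' (g := fun _ => ENNReal.ofReal
      ((normWT T α g).toReal * (T - s) ^ (1 - α) / (r - s) ^ (2 - α)))
      measurableSet_Ico fun y hy => ENNReal.ofReal_le_ofReal ?_) ?_
    · have hsy : s < y := hr.1.trans_le hy.1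
      have h0 : 0 < r - s := by linarith [hr.1]
      refine div_le_div₀ (by
          have : 0 ≤ T - s := by linarith [hs.2]
          positivity) ((hg.norm_sub_le hs.1 hsy hy.2).trans ?_) (by positivity) ?_
      · exact mul_le_mul_of_nonneg_left (Real.rpow_le_rpow (by linarith) (by linarith [hy.2])
          (by linarith)) ENNReal.toReal_nonneg
      · exact Real.rpow_le_rpow h0.le (by linarith [hy.1]) (by linarith)
    · rw [setLIntegral_const, Real.volume_Ico]
      exact ENNReal.mul_lt_top ENNReal.ofReal_lt_top ENNReal.ofReal_lt_top

theorem MemWT.norm_weylRight_le (hg : MemWT T α g) (hα0 : 0 < α) (hα : α < 1) {s t : ℝ}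
    (hs : 0 < s) (hst : s < t) (ht : t < T) :
    ‖weylRight (1 - α) g t s‖ ≤ 1 / Real.Gamma α * (2 * (normWT T α g).toReal) := by
  have hΓ : 0 < Real.Gamma α := Real.Gamma_pos_of_pos hα0
  have hN := hg.add_le_norm hs hst ht
  have hp : 0 < (t - s) ^ (1 - α) := Real.rpow_pos_of_pos (by linarith) _
  unfold weylRight
  rw [hg.leftLim_eq hα ⟨hs.trans hst, ht⟩, sub_sub_cancel, norm_smul,
    Real.norm_of_nonneg (by positivity), two_mul]
  refine mul_le_mul_of_nonneg_left ((norm_add_le _ _).trans (add_le_add ?_ ?_)) (by positivity)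
  · rw [norm_smul, norm_inv, Real.norm_of_nonneg hp.le, inv_mul_le_iff₀ hp, norm_sub_rev, mul_comm]
    exact hg.norm_sub_le hs hst ht
  · rw [norm_smul, Real.norm_of_nonneg (by linarith)]
    refine (mul_le_of_le_one_left (norm_nonneg _) (by linarith)).trans ?_
    rw [← ENNReal.ofReal_le_ofReal_iff ENNReal.toReal_nonneg]
    refine le_trans ?_ (le_add_self.trans hN)
    rw [ofReal_norm, intervalIntegral.integral_of_le hst.le, integral_Ioc_eq_integral_Ioo]
    refine (enorm_integral_le_lintegral_enorm _).trans (le_of_eq ?_)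
    refine setLIntegral_congr_fun measurableSet_Ioo fun y hy => ?_
    have : 0 ≤ (y - s) ^ (1 - α + 1) := Real.rpow_nonneg (by linarith [hy.1]) _
    rw [← ofReal_norm, norm_smul, norm_inv, Real.norm_of_nonneg this, norm_sub_rev,
      show 1 - α + 1 = 2 - α by ring, div_eq_inv_mul]

theorem Lam_nonneg (hα : α < 1) : 0 ≤ Lam T α g := by
  have hΓ : 0 < Real.Gamma (1 - α) := Real.Gamma_pos_of_pos (by linarith)
  refine mul_nonneg (by positivity) (Real.sSup_nonneg ?_)
  rintro r ⟨s, t, -, -, -, rfl⟩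
  exact norm_nonneg _

theorem MemWT.norm_weylRight_le_Lam (hg : MemWT T α g) (hα0 : 0 < α) (hα : α < 1) {s t : ℝ}
    (hs : 0 < s) (hst : s < t) (ht : t < T) :
    ‖weylRight (1 - α) g t s‖ ≤ Real.Gamma (1 - α) * Lam T α g := by
  have hΓ : 0 < Real.Gamma (1 - α) := Real.Gamma_pos_of_pos (by linarith)
  unfold Lam
  rw [← mul_assoc, mul_one_div, div_self hΓ.ne', one_mul]
  refine le_csSup ⟨1 / Real.Gamma α * (2 * (normWT T α g).toReal), ?_⟩ ⟨s, t, hs, hst, ht, rfl⟩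
  rintro r ⟨s', t', h1, h2, h3, rfl⟩
  exact hg.norm_weylRight_le hα0 hα h1 h2 h3

/-- The bound by `Λ_α(g)` extends to the right end point `T`, where the Weyl derivative is the limit
of those at `t < T`. -/
theorem MemWT.norm_weylRight_end_le [CompleteSpace E] (hg : MemWT T α g) (hα0 : 0 < α)
    (hα : α < 1) {s : ℝ} (hs : s ∈ Ioo 0 T) :
    ‖weylRight (1 - α) g T s‖ ≤ Real.Gamma (1 - α) * Lam T α g := by
  have hT : 0 < T := hs.1.trans hs.2
  have hlim : Tendsto (fun t => weylRight (1 - α) g t s) (𝓝[<] T)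
      (𝓝 (weylRight (1 - α) g T s)) := by
    unfold weylRight
    refine Tendsto.const_smul (Tendsto.add (Tendsto.smul ?_ ?_) (Tendsto.const_smul ?_ _)) _
    · have hc : ContinuousAt (fun t : ℝ => ((t - s) ^ (1 - α))⁻¹) T := by
        have h0 : 0 < T - s := by linarith [hs.2]
        exact ((continuousAt_id.sub continuousAt_const).rpow_const (Or.inl h0.ne')).inv₀
          (Real.rpow_pos_of_pos h0 _).ne'
      exact hc.tendsto.mono_left nhdsWithin_le_nhds
    · refine tendsto_const_nhds.sub ((hg.tendsto_leftLim hα hT).congr' ?_)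
      filter_upwards [Ioo_mem_nhdsLT hT] with t ht
      exact (hg.leftLim_eq hα ht).symm
    · have hc := intervalIntegral.continuousOn_primitive_interval
        ((intervalIntegrable_iff_integrableOn_Icc_of_le hs.2.le).1 (hg.integrable_kernel hα hs)
          |> fun h => by rwa [uIcc_of_le hs.2.le])
      rw [uIcc_of_le hs.2.le] at hc
      refine (hc T ⟨hs.2.le, le_rfl⟩).tendsto.mono_left ?_
      exact nhdsWithin_le_of_mem (mem_of_superset (Ioo_mem_nhdsLT hs.2) Ioo_subset_Icc_self)
  refine le_of_tendsto hlim.norm ?_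
  filter_upwards [Ioo_mem_nhdsLT hs.2] with t ht
  exact hg.norm_weylRight_le_Lam hα0 hα hs.1 ht.1 ht.2

theorem MemWT.weylRight_apply {m : ℕ} {g : ℝ → Vec m} (hg : MemWT T α g) (hα : α < 1) {s : ℝ}
    (hs : s ∈ Ioo 0 T) (j : Fin m) :
    weylRight (1 - α) (fun r => g r j) T s = weylRight (1 - α) g T s j := by
  have hT : 0 < T := hs.1.trans hs.2
  have h1 : Function.leftLim (fun r => g r j) T = Function.leftLim g T j := by
    refine leftLim_eq_of_tendsto ?_
    exact ((EuclideanSpace.proj (𝕜 := ℝ) j).continuous.tendsto _).comp (hg.tendsto_leftLim hα hT)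
  have h2 : (∫ y in s..T, ((y - s) ^ (1 - α + 1))⁻¹ • (g s - g y)) j =
      ∫ y in s..T, ((y - s) ^ (1 - α + 1))⁻¹ • (g s j - g y j) :=
    ((EuclideanSpace.proj (𝕜 := ℝ) j).intervalIntegral_comp_comm
      (hg.integrable_kernel hα hs)).symm
  unfold weylRight
  simp only [PiLp.smul_apply, PiLp.add_apply, PiLp.sub_apply, h1, h2]

theorem MemWT.norm_weylRight_apply_le {m : ℕ} {g : ℝ → Vec m} (hg : MemWT T α g) (hα0 : 0 < α)
    (hα : α < 1) (j : Fin m) :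
    ∀ s ∈ Ioo 0 T, ‖weylRight (1 - α) (fun r => g r j) T s‖ ≤
      Real.Gamma (1 - α) * Lam T α g := fun s hs => by
  rw [hg.weylRight_apply hα hs j]
  exact (PiLp.norm_apply_le _ j).trans (hg.norm_weylRight_end_le hα0 hα hs)

theorem aestronglyMeasurable_weylRight {a : ℝ} {h : ℝ → ℝ}
    (hh : AEStronglyMeasurable h (volume.restrict (Icc 0 T))) :
    AEStronglyMeasurable (weylRight a h T) (volume.restrict (Ioo 0 T)) := by
  -- Off `[0, T]` the values of the function do not matter.
  set G := (Icc 0 T).indicator h with hG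
  have hGm : AEStronglyMeasurable G volume :=
    (aestronglyMeasurable_indicator_iff measurableSet_Icc).2 hh
  have h1 : AEStronglyMeasurable (fun p : ℝ × ℝ => G p.1) (volume.prod volume) := hGm.comp_fst
  have h2 : AEStronglyMeasurable (fun p : ℝ × ℝ => G p.2) (volume.prod volume) := hGm.comp_snd
  have hS : MeasurableSet {p : ℝ × ℝ | p.1 < p.2 ∧ p.2 ≤ T} :=
    (measurableSet_lt measurable_fst measurable_snd).inter
      (measurableSet_le measurable_snd measurable_const)
  have h3 : AEStronglyMeasurable ({p : ℝ × ℝ | p.1 < p.2 ∧ p.2 ≤ T}.indicator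
      (fun p : ℝ × ℝ => ((p.2 - p.1) ^ (a + 1))⁻¹ • (G p.1 - G p.2))) (volume.prod volume) :=
    ((((measurable_snd.sub measurable_fst).pow_const _).inv.aestronglyMeasurable).smul
      (h1.sub h2)).indicator hS
  have h4 : AEStronglyMeasurable (fun s => ((T - s) ^ a)⁻¹ • (G s - Function.leftLim h T))
      (volume.restrict (Ioo 0 T)) :=
    ((((measurable_const.sub measurable_id).pow_const _).inv.aestronglyMeasurable).smul
      (hGm.sub aestronglyMeasurable_const)).restrict
  refine ((h4.add (h3.integral_prod_right'.restrict.const_smul a)).const_smul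
    (1 / Real.Gamma (1 - a))).congr
    ((ae_restrict_iff' measurableSet_Ioo).2 (Eventually.of_forall fun s hs => ?_))
  have hGs : ∀ y ∈ Ioc s T, G y = h y := fun y hy =>
    indicator_of_mem (s := Icc 0 T) ⟨(hs.1.trans hy.1).le, hy.2⟩ h
  have hGs' : G s = h s := indicator_of_mem (Ioo_subset_Icc_self hs) h
  have e : ∫ y, ({p : ℝ × ℝ | p.1 < p.2 ∧ p.2 ≤ T}.indicator
      (fun p : ℝ × ℝ => ((p.2 - p.1) ^ (a + 1))⁻¹ • (G p.1 - G p.2))) (s, y) =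
      ∫ y in s..T, ((y - s) ^ (a + 1))⁻¹ • (h s - h y) := by
    rw [intervalIntegral.integral_of_le hs.2.le, ← integral_indicator measurableSet_Ioc]
    refine integral_congr_ae (Eventually.of_forall fun y => ?_)
    by_cases hy : y ∈ Ioc s T
    · rw [indicator_of_mem hy, ← hGs y hy, ← hGs']
      exact indicator_of_mem (s := {p : ℝ × ℝ | p.1 < p.2 ∧ p.2 ≤ T}) (a := (s, y)) hy _
    · rw [indicator_of_notMem hy]
      exact indicator_of_notMem (s := {p : ℝ × ℝ | p.1 < p.2 ∧ p.2 ≤ T}) (a := (s, y)) hy _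
  change (1 / Real.Gamma (1 - a)) • (((T - s) ^ a)⁻¹ • (G s - Function.leftLim h T) +
    a • ∫ y, _) = _
  rw [e, hGs']
  rfl

end

/-! ### The coefficients along a path -/

theorem aestronglyMeasurable_comp_path {d : ℕ} {E : Type*} [NormedAddCommGroup E]
    [MeasurableSpace E] [BorelSpace E] [SecondCountableTopology E] {T : ℝ} (hT : 0 < T)
    {G : ℝ → ℝ → Vec d → E}
    (hG : Measurable
      (fun p : Icc (0 : ℝ) T × Icc (0 : ℝ) T × Vec d => G (p.1 : ℝ) (p.2.1 : ℝ) p.2.2))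
    {x : ℝ → Vec d} (hx : AEStronglyMeasurable x (volume.restrict (Icc 0 T)))
    {t : ℝ} (ht : t ∈ Icc 0 T) :
    AEStronglyMeasurable (fun u => G t u (x u)) (volume.restrict (Icc 0 T)) := by
  have hm : Measurable fun u : ℝ =>
      G t ((projIcc 0 T hT.le u : Icc (0 : ℝ) T) : ℝ) (hx.mk x u) :=
    hG.comp ((measurable_const (a := (⟨t, ht⟩ : Icc (0 : ℝ) T))).prodMk
      ((continuous_projIcc (h := hT.le)).measurable.prodMk hx.stronglyMeasurable_mk.measurable))
  refine hm.aestronglyMeasurable.congr ?_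
  filter_upwards [hx.ae_eq_mk, ae_restrict_mem measurableSet_Icc] with u hu hu'
  rw [projIcc_of_mem hT.le hu', hu]

section Diffusion

variable {d m : ℕ} {T β μ δ K : ℝ} {KN : ℝ → ℝ} {σ : ℝ → ℝ → Vec d → Mat d m}

theorem H1.norm_sub_le (h : H1 T β μ δ K KN σ) {t u v : ℝ} (ht : t ∈ Icc 0 T) (hu : u ∈ Icc 0 T)
    (hv : v ∈ Icc 0 T) (p q : Vec d) :
    ‖σ t u p - σ t v q‖ ≤ K * (|u - v| ^ β + ‖p - q‖) := by
  have h1 := h.lipschitz_x t ht u hu p q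
  have h2 := h.holder_s t ht u hu v hv q
  calc ‖σ t u p - σ t v q‖ ≤ ‖σ t u p - σ t u q‖ + ‖σ t u q - σ t v q‖ :=
        norm_sub_le_norm_sub_add_norm_sub _ _ _
    _ ≤ K * ‖p - q‖ + K * |u - v| ^ β := by
        linarith [norm_nonneg (dt T σ t u p - dt T σ t u q),
          norm_nonneg (dt T σ t u q - dt T σ t v q)]
    _ = _ := by ring

/-- Rectangular increments of `σ`, by the mean value theorem in the first variable. -/
theorem H1.norm_sub_sub_le (h : H1 T β μ δ K KN σ) {s t u v : ℝ} (hs : s ∈ Icc 0 T)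
    (ht : t ∈ Icc 0 T) (hu : u ∈ Icc 0 T) (hv : v ∈ Icc 0 T) (p q : Vec d) :
    ‖(σ t u p - σ s u p) - (σ t v q - σ s v q)‖ ≤ K * (|u - v| ^ β + ‖p - q‖) * |t - s| := by
  have key := (convex_Icc (0 : ℝ) T).norm_image_sub_le_of_norm_hasDerivWithin_le
    (f := fun r => σ r u p - σ r v q) (f' := fun r => dt T σ r u p - dt T σ r v q)
    (C := K * (|u - v| ^ β + ‖p - q‖))
    (fun r hr => (h.exists_dt r hr u hu p).hasDerivWithinAt.sub
      (h.exists_dt r hr v hv q).hasDerivWithinAt) (fun r hr => ?_) hs ht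
  · rw [Real.norm_eq_abs] at key
    rwa [sub_sub_sub_comm]
  · have h1 := h.lipschitz_x r hr u hu p q
    have h2 := h.holder_s r hr u hu v hv q
    calc ‖dt T σ r u p - dt T σ r v q‖ ≤
          ‖dt T σ r u p - dt T σ r u q‖ + ‖dt T σ r u q - dt T σ r v q‖ :=
          norm_sub_le_norm_sub_add_norm_sub _ _ _
      _ ≤ K * ‖p - q‖ + K * |u - v| ^ β := by
          linarith [norm_nonneg (σ r u p - σ r u q), norm_nonneg (σ r u q - σ r v q)]
      _ = _ := by ring

theorem H3.norm_le {γ K₀ : ℝ} (h : H3 T γ K₀ σ) (hγ₀ : 0 ≤ γ) (hγ₁ : γ ≤ 1) (hK₀ : 0 < K₀)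
    {t u : ℝ} (ht : t ∈ Icc 0 T) (hu : u ∈ Icc 0 T) (p : Vec d) :
    ‖σ t u p‖ ≤ K₀ * (2 + ‖p‖) := by
  refine (h t ht u hu p).trans (mul_le_mul_of_nonneg_left ?_ hK₀.le)
  have : ‖p‖ ^ γ ≤ 1 + ‖p‖ := by
    rcases le_total ‖p‖ 1 with h1 | h1
    · linarith [Real.rpow_le_one (norm_nonneg p) h1 hγ₀, norm_nonneg p]
    · have := Real.rpow_le_rpow_of_exponent_le h1 hγ₁
      rw [Real.rpow_one] at this
      linarith
  linarith

end Diffusion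

section Drift

variable {d : ℕ} {T α μ L L₀ : ℝ} {LN : ℝ → ℝ} {B : NNReal} {b : ℝ → ℝ → Vec d → Vec d}

/-- The bound `b₀` is only known to be integrable on the square, not on its slices. Since `b` is
Hölder continuous in `t` uniformly in the other variables, the growth bound at `t` may be replaced
by its average over all `t'`, and Hölder's inequality on a rectangle gives the exponent `1 - α`. -/
theorem H2.lintegral_le (h : H2 T (1 / α) μ L L₀ LN B b) (hT : 0 < T) (hα0 : 0 < α)
    (hα1 : α < 1) (hμ : 0 < μ) (hL : 0 < L)
    {x : ℝ → Vec d} (hx : AEStronglyMeasurable x (volume.restrict (Icc 0 T)))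
    {t a c : ℝ} (ht : t ∈ Icc 0 T) (ha : 0 ≤ a) (hac : a ≤ c) (hc : c ≤ T) :
    ∫⁻ u in Ioo a c, ‖b t u (x u)‖ₑ ≤ (∫⁻ u in Ioo a c, ENNReal.ofReal (L₀ * ‖x u‖)) +
      ENNReal.ofReal ((L * T ^ μ * T ^ α + B * T ^ (-α)) * (c - a) ^ (1 - α)) := by
  obtain ⟨b₀, hb₀, hB, hgr⟩ := h.growth
  have hsub : Ioo a c ⊆ Icc 0 T := fun u hu => ⟨ha.trans hu.1.le, hu.2.le.trans hc⟩
  have hxm : AEMeasurable (fun u => ENNReal.ofReal (L₀ * ‖x u‖)) (volume.restrict (Ioo a c)) :=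
    ((hx.mono_measure (Measure.restrict_mono hsub le_rfl)).norm.aemeasurable.const_mul
      _).ennreal_ofReal
  set D := ENNReal.ofReal (L * T ^ μ) * ENNReal.ofReal (c - a) +
    ∫⁻ u in Ioo a c, ENNReal.ofReal (L₀ * ‖x u‖) with hD
  have step1 : ∀ t' ∈ Icc 0 T, ∫⁻ u in Ioo a c, ‖b t u (x u)‖ₑ ≤
      D + ∫⁻ u in Ioo a c, ‖b₀ (t', u)‖ₑ := by
    intro t' ht'
    calc _ ≤ ∫⁻ u in Ioo a c, ((ENNReal.ofReal (L * T ^ μ) + ENNReal.ofReal (L₀ * ‖x u‖)) +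
          ‖b₀ (t', u)‖ₑ) := by
          refine setLIntegral_mono' measurableSet_Ioo fun u hu => ?_
          have h1 := h.holder_t t ht t' ht' u (hsub hu) (x u)
          have h2 := hgr t' ht' u (hsub hu) (x u)
          have h3 : |t - t'| ^ μ ≤ T ^ μ := Real.rpow_le_rpow (abs_nonneg _)
            (abs_sub_le_iff.2 ⟨by linarith [ht.2, ht'.1], by linarith [ht.1, ht'.2]⟩) hμ.le
          have h4 : ‖b t u (x u)‖ ≤ L * T ^ μ + ‖L₀ * ‖x u‖ + b₀ (t', u)‖ := by
            have := norm_le_norm_add_norm_sub' (b t u (x u)) (b t' u (x u))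
            have := mul_le_mul_of_nonneg_left h3 hL.le
            have := Real.le_norm_self (L₀ * ‖x u‖ + b₀ (t', u))
            linarith
          rw [← ofReal_norm, ← ofReal_norm]
          by_cases h0 : 0 ≤ L₀ * ‖x u‖
          · rw [← ENNReal.ofReal_add (by positivity) h0,
              ← ENNReal.ofReal_add (by positivity) (norm_nonneg _)]
            refine ENNReal.ofReal_le_ofReal (h4.trans ?_)
            have := norm_add_le (L₀ * ‖x u‖) (b₀ (t', u))
            rw [Real.norm_of_nonneg h0] at this
            linarith
          · rw [ENNReal.ofReal_of_nonpos (le_of_not_ge h0), add_zero,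
              ← ENNReal.ofReal_add (by positivity) (norm_nonneg _)]
            refine ENNReal.ofReal_le_ofReal ?_
            have := norm_le_norm_add_norm_sub' (b t u (x u)) (b t' u (x u))
            have := mul_le_mul_of_nonneg_left h3 hL.le
            have := Real.le_norm_self (b₀ (t', u))
            linarith
      _ = _ := by
          rw [lintegral_add_left' (show AEMeasurable (fun u =>
              ENNReal.ofReal (L * T ^ μ) + ENNReal.ofReal (L₀ * ‖x u‖)) _ from
                aemeasurable_const.add hxm),
            lintegral_add_left' aemeasurable_const, setLIntegral_const, Real.volume_Ioo]
  have hα' : (1 : ENNReal) ≤ ENNReal.ofReal (1 / α) := by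
    rw [← ENNReal.ofReal_one]
    exact ENNReal.ofReal_le_ofReal (by rw [le_div_iff₀ hα0]; linarith)
  have step2 : ∫⁻ t' in Icc 0 T, ∫⁻ u in Ioo a c, ‖b₀ (t', u)‖ₑ ≤
      ENNReal.ofReal (B * (T * (c - a)) ^ (1 - α)) := by
    have hle : (volume.restrict (Icc 0 T)).prod (volume.restrict (Ioo a c)) ≤
        (volume : Measure (ℝ × ℝ)).restrict (Icc 0 T ×ˢ Icc 0 T) := by
      rw [Measure.prod_restrict, ← Measure.volume_eq_prod]
      exact Measure.restrict_mono (prod_mono le_rfl hsub) le_rfl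
    have hm := hb₀.aestronglyMeasurable.mono_measure hle
    rw [← lintegral_prod _ hm.enorm, ← eLpNorm_one_eq_lintegral_enorm]
    refine (eLpNorm_le_eLpNorm_mul_rpow_measure_univ hα' hm).trans ?_
    rw [ENNReal.ofReal_mul B.coe_nonneg, ENNReal.ofReal_coe_nnreal]
    refine mul_le_mul' ((eLpNorm_mono_measure _ hle).trans hB) (le_of_eq ?_)
    rw [ENNReal.toReal_ofReal (by positivity), one_div_one_div, ENNReal.toReal_one, div_one,
      ← univ_prod_univ, Measure.prod_prod, Measure.restrict_apply_univ,
      Measure.restrict_apply_univ, Real.volume_Icc, Real.volume_Ioo, sub_zero,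
      ← ENNReal.ofReal_mul hT.le, ENNReal.ofReal_rpow_of_nonneg
        (mul_nonneg hT.le (by linarith)) (by linarith)]
  have step3 : ENNReal.ofReal T * ∫⁻ u in Ioo a c, ‖b t u (x u)‖ₑ ≤
      ENNReal.ofReal T * D + ENNReal.ofReal (B * (T * (c - a)) ^ (1 - α)) := by
    have := setLIntegral_mono' (μ := volume) measurableSet_Icc step1
    rw [lintegral_add_left measurable_const, setLIntegral_const, setLIntegral_const,
      Real.volume_Icc, sub_zero, mul_comm, mul_comm D] at this
    exact this.trans (add_le_add le_rfl step2)
  have hT' : ENNReal.ofReal T ≠ 0 := by simpa using hT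
  rw [← ENNReal.mul_le_mul_iff_right hT' ENNReal.ofReal_ne_top]
  refine step3.trans ?_
  have hca : 0 ≤ c - a := by linarith
  have e1 : B * (T * (c - a)) ^ (1 - α) = T * (B * T ^ (-α) * (c - a) ^ (1 - α)) := by
    rw [Real.mul_rpow hT.le hca, sub_eq_add_neg, Real.rpow_add hT, Real.rpow_one]
    ring
  have e2 : L * T ^ μ * (c - a) ≤ L * T ^ μ * T ^ α * (c - a) ^ (1 - α) := by
    rw [mul_assoc (L * T ^ μ) (T ^ α)]
    refine mul_le_mul_of_nonneg_left ?_ (by positivity)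
    rcases hca.eq_or_lt with h0 | h0
    · rw [← h0]; positivity
    · calc c - a = (c - a) ^ α * (c - a) ^ (1 - α) := by
            rw [← Real.rpow_add h0, add_sub_cancel, Real.rpow_one]
        _ ≤ T ^ α * (c - a) ^ (1 - α) := mul_le_mul_of_nonneg_right
            (Real.rpow_le_rpow hca (by linarith) hα0.le) (Real.rpow_nonneg hca _)
  rw [e1, ENNReal.ofReal_mul hT.le, ← mul_add]
  refine mul_le_mul_right ?_ _
  rw [hD, add_comm (ENNReal.ofReal _ * _), add_assoc, ← ENNReal.ofReal_mul (by positivity), add_mul,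
    ENNReal.ofReal_add (by positivity) (by positivity)]
  gcongr

theorem H2.enorm_integral_sub_le (h : H2 T (1 / α) μ L L₀ LN B b) (hT : 0 < T) (hα0 : 0 < α)
    (hα1 : α < 1) (hμ : 0 < μ) (hL : 0 < L)
    {x : ℝ → Vec d} (hx : AEStronglyMeasurable x (volume.restrict (Icc 0 T)))
    (hfin : ∫⁻ u in Ioo 0 T, ENNReal.ofReal (L₀ * ‖x u‖) < ⊤)
    {s t : ℝ} (hs : 0 ≤ s) (hst : s ≤ t) (ht : t ≤ T) (i : Fin d) :
    ‖(∫ u in (0 : ℝ)..t, b t u (x u) i) - ∫ u in (0 : ℝ)..s, b s u (x u) i‖ₑ ≤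
      ENNReal.ofReal (L * T * (t - s) ^ μ) + ∫⁻ u in Ioo s t, ‖b t u (x u)‖ₑ := by
  have hint : ∀ r ∈ Icc 0 T, IntegrableOn (fun u => b r u (x u)) (Ioo 0 T) := by
    intro r hr
    refine ⟨(aestronglyMeasurable_comp_path hT h.measurable hx hr).mono_measure
      (Measure.restrict_mono Ioo_subset_Icc_self le_rfl), ?_⟩
    exact (h.lintegral_le hT hα0 hα1 hμ hL hx hr le_rfl hT.le le_rfl).trans_lt
      (ENNReal.add_lt_top.2 ⟨hfin, ENNReal.ofReal_lt_top⟩)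
  have hint' : ∀ r ∈ Icc 0 T, ∀ p q : ℝ, 0 ≤ p → p ≤ q → q ≤ T →
      IntervalIntegrable (fun u => b r u (x u) i) volume p q := by
    intro r hr p q hp hpq hq
    rw [intervalIntegrable_iff_integrableOn_Ioo_of_le hpq]
    exact ((EuclideanSpace.proj (𝕜 := ℝ) i).integrable_comp (hint r hr)).mono_measure
      (Measure.restrict_mono (Ioo_subset_Ioo hp hq) le_rfl)
  have htI : t ∈ Icc 0 T := ⟨hs.trans hst, ht⟩
  have hsI : s ∈ Icc 0 T := ⟨hs, hst.trans ht⟩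
  rw [← intervalIntegral.integral_add_adjacent_intervals
    (hint' t htI 0 s le_rfl hs hsI.2) (hint' t htI s t hs hst ht), add_sub_right_comm,
    ← intervalIntegral.integral_sub (hint' t htI 0 s le_rfl hs hsI.2)
      (hint' s hsI 0 s le_rfl hs hsI.2)]
  refine (enorm_add_le _ _).trans (add_le_add ?_ ?_)
  · rw [← ofReal_norm]
    refine ENNReal.ofReal_le_ofReal ?_
    refine (intervalIntegral.norm_integral_le_of_norm_le_const (C := L * (t - s) ^ μ)
      fun u hu => ?_).trans ?_
    · rw [uIoc_of_le hs] at hu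
      have hb := h.holder_t t htI s hsI u ⟨hu.1.le, hu.2.trans hsI.2⟩ (x u)
      rw [abs_of_nonneg (by linarith)] at hb
      exact (PiLp.norm_apply_le (b t u (x u) - b s u (x u)) i).trans hb
    · rw [sub_zero, abs_of_nonneg hs, mul_right_comm]
      have : 0 ≤ (t - s) ^ μ := Real.rpow_nonneg (by linarith) _
      gcongr
      exact hsI.2
  · rw [intervalIntegral.integral_of_le hst, integral_Ioc_eq_integral_Ioo]
    refine (enorm_integral_le_lintegral_enorm _).trans (lintegral_mono fun u => ?_)
    rw [← ofReal_norm, ← ofReal_norm]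
    exact ENNReal.ofReal_le_ofReal (PiLp.norm_apply_le _ i)

end Drift

/-! ### Increments of solutions in exponentially weighted norms -/

/-- The singular part `∫_0^t |x(t) - x(s)| / (t - s)^{α+1} ds` of the norm of `W_0^{α,∞}`. -/
def singularPart {E : Type*} [NormedAddCommGroup E] (α : ℝ) (x : ℝ → E) (t : ℝ) : ENNReal :=
  ∫⁻ s in Ioo (0 : ℝ) t, ENNReal.ofReal (‖x t - x s‖ / (t - s) ^ (α + 1))

section Mass

variable {E E' : Type*} [NormedAddCommGroup E] [NormedAddCommGroup E']

theorem lintegral_kernel_le_singularPart {T α β k a u : ℝ} {f : ℝ → E} {x : ℝ → E'}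
    (hαβ : α < β) (hk : 0 ≤ k) (ha : 0 ≤ a) (hau : a ≤ u) (hu : u ≤ T)
    (hf : ∀ y ∈ Ioo a u, ‖f u - f y‖ ≤ k * (|u - y| ^ β + ‖x u - x y‖)) :
    ∫⁻ y in Ioo a u, ENNReal.ofReal (‖f u - f y‖ / (u - y) ^ (α + 1)) ≤
      ENNReal.ofReal k * (ENNReal.ofReal (T ^ (β - α) / (β - α)) + singularPart α x u) := by
  have hβα : 0 < β - α := by linarith
  calc _ ≤ ∫⁻ y in Ioo a u, ENNReal.ofReal k * (ENNReal.ofReal ((u - y) ^ (β - α - 1)) +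
        ENNReal.ofReal (‖x u - x y‖ / (u - y) ^ (α + 1))) := by
        refine setLIntegral_mono' measurableSet_Ioo fun y hy => ?_
        have h0 : 0 < u - y := by linarith [hy.2]
        have h1 : 0 < (u - y) ^ (α + 1) := Real.rpow_pos_of_pos h0 _
        have h2 : (u - y) ^ β = (u - y) ^ (β - α - 1) * (u - y) ^ (α + 1) := by
          rw [← Real.rpow_add h0]; congr 1; ring
        rw [← ENNReal.ofReal_add (by positivity) (by positivity), ← ENNReal.ofReal_mul hk]
        refine ENNReal.ofReal_le_ofReal ?_
        rw [div_le_iff₀ h1]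
        refine (hf y hy).trans (le_of_eq ?_)
        rw [abs_of_pos h0, h2]
        field_simp
    _ = ENNReal.ofReal k * ((∫⁻ y in Ioo a u, ENNReal.ofReal ((u - y) ^ (β - α - 1))) +
        ∫⁻ y in Ioo a u, ENNReal.ofReal (‖x u - x y‖ / (u - y) ^ (α + 1))) := by
        rw [lintegral_const_mul' _ _ ENNReal.ofReal_ne_top, lintegral_add_left (by fun_prop)]
    _ ≤ _ := by
        gcongr
        · rw [lintegral_Ioo_sub_right_rpow (by linarith) hau, sub_add_cancel]
          refine ENNReal.ofReal_le_ofReal (div_le_div_of_nonneg_right ?_ hβα.le)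
          exact Real.rpow_le_rpow (by linarith) (by linarith) hβα.le
        · exact lintegral_mono_set (Ioo_subset_Ioo_left ha)

theorem weylMass_indicator_le_exp {T α β l A k Q a t : ℝ} {f : ℝ → E} {x : ℝ → E'}
    (hα0 : 0 < α) (hα1 : α < 1) (hαβ : α < β) (hl : 0 < l) (hA : 0 ≤ A) (hk : 0 ≤ k) (hQ : 0 ≤ Q)
    (ha : 0 ≤ a) (hat : a ≤ t) (ht : t ≤ T)
    (hfm : AEStronglyMeasurable f (volume.restrict (Ico a t)))
    (hfA : ∀ u ∈ Ioo a t, ‖f u‖ ≤ A * Real.exp (l * u))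
    (hf : ∀ u ∈ Ioo a t, ∀ y ∈ Ioo a u, ‖f u - f y‖ ≤ k * (|u - y| ^ β + ‖x u - x y‖))
    (hx : ∀ u ∈ Ioo a t, singularPart α x u ≤ ENNReal.ofReal (Q * Real.exp (l * u))) :
    weylMass T α ((Ico a t).indicator f) ≤ ENNReal.ofReal (Real.exp (l * t) *
      ((1 + 1 / α) * (2 / (1 - α) + 2) * A * min (1 / l) (t - a) ^ (1 - α) +
        k * (T ^ (β - α) / (β - α) + Q) * min (1 / l) (t - a))) := by
  refine (weylMass_indicator_le hα0 ha hfm).trans ?_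
  rcases hat.eq_or_lt with rfl | hat'
  · simp
  have hβα : 0 < β - α := by linarith
  have h1α : 0 < 1 - α := by linarith
  have hT : 0 < T := by linarith
  have hE := Real.exp_pos (l * t)
  have hw : 0 < min (1 / l) (t - a) := lt_min (by positivity) (by linarith)
  have i1 : ∫⁻ u in Ioo a t, ENNReal.ofReal (‖f u‖ * ((u - a) ^ (-α) + (t - u) ^ (-α))) ≤
      ENNReal.ofReal A * ENNReal.ofReal ((2 / (1 - α) + 2) *
        (Real.exp (l * t) * min (1 / l) (t - a) ^ (1 - α))) := by
    refine le_trans ?_ (mul_le_mul_right (lintegral_exp_mul_kernel_le hα0 hα1 hl hat') _)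
    rw [← lintegral_const_mul' _ _ ENNReal.ofReal_ne_top]
    refine setLIntegral_mono' measurableSet_Ioo fun u hu => ?_
    rw [← ENNReal.ofReal_mul hA, ← mul_assoc]
    refine ENNReal.ofReal_le_ofReal (mul_le_mul_of_nonneg_right (hfA u hu) ?_)
    exact add_nonneg (Real.rpow_nonneg (by linarith [hu.1]) _)
      (Real.rpow_nonneg (by linarith [hu.2]) _)
  have i2 : ∫⁻ u in Ioo a t, ∫⁻ y in Ioo a u, ENNReal.ofReal (‖f u - f y‖ / (u - y) ^ (α + 1)) ≤
      ENNReal.ofReal (k * (T ^ (β - α) / (β - α) + Q)) *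
        ENNReal.ofReal (Real.exp (l * t) * min (1 / l) (t - a)) := by
    refine le_trans ?_ (mul_le_mul_right (lintegral_Ioo_exp_le hl hat) _)
    rw [← lintegral_const_mul' _ _ ENNReal.ofReal_ne_top]
    refine setLIntegral_mono' measurableSet_Ioo fun u hu => ?_
    refine (lintegral_kernel_le_singularPart hαβ hk ha hu.1.le (hu.2.le.trans ht)
      (hf u hu)).trans ?_
    have hu0 : 0 ≤ l * u := mul_nonneg hl.le (by linarith [hu.1])
    calc _ ≤ ENNReal.ofReal k * (ENNReal.ofReal (T ^ (β - α) / (β - α) * Real.exp (l * u)) +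
          ENNReal.ofReal (Q * Real.exp (l * u))) := by
          gcongr
          · exact le_mul_of_one_le_right (by positivity) (Real.one_le_exp hu0)
          · exact hx u hu
      _ = _ := by
          rw [← ENNReal.ofReal_add (by positivity) (by positivity), ← add_mul,
            ← ENNReal.ofReal_mul hk, ← ENNReal.ofReal_mul (by positivity), mul_assoc]
  refine (add_le_add (mul_le_mul_right i1 _) i2).trans (le_of_eq ?_)
  rw [← ENNReal.ofReal_mul hA, ← ENNReal.ofReal_mul (by positivity),
    ← ENNReal.ofReal_mul (by positivity), ← ENNReal.ofReal_add (by positivity) (by positivity)]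
  congr 1
  ring

end Mass

theorem stieltjes_congr {T α : ℝ} (hT : 0 < T) {F G g : ℝ → ℝ} (h : ∀ u, 0 < u → F u = G u) :
    stieltjes T α F g = stieltjes T α G g := by
  unfold stieltjes weylLeft
  rw [intervalIntegral.integral_of_le hT.le, intervalIntegral.integral_of_le hT.le]
  congr 1
  refine setIntegral_congr_fun measurableSet_Ioc fun s hs => ?_
  have e : ∫ y in (0 : ℝ)..s, (F s - F y) / (s - y) ^ (α + 1) =
      ∫ y in (0 : ℝ)..s, (G s - G y) / (s - y) ^ (α + 1) := by
    rw [intervalIntegral.integral_of_le hs.1.le, intervalIntegral.integral_of_le hs.1.le]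
    refine setIntegral_congr_fun measurableSet_Ioc fun y hy => ?_
    simp only [h s hs.1, h y hy.1]
  rw [e, h s hs.1]

theorem stieltjesTo_eq {T α : ℝ} (hT : 0 < T) (f g : ℝ → ℝ) (t : ℝ) :
    stieltjesTo T α f g t = stieltjes T α ((Ico (0 : ℝ) t).indicator f) g := by
  refine stieltjes_congr hT fun u hu => ?_
  by_cases h : u < t
  · rw [indicator_of_mem (show u ∈ Ioo 0 t from ⟨hu, h⟩),
      indicator_of_mem (show u ∈ Ico 0 t from ⟨hu.le, h⟩)]
  · rw [indicator_of_notMem (fun h' : u ∈ Ioo 0 t => h h'.2),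
      indicator_of_notMem (fun h' : u ∈ Ico 0 t => h h'.2)]

/-- The constant of the estimate for the increments of the stochastic integral. -/
def diffusionConst (T α β μ K K₀ : ℝ) : ℝ :=
  (1 + 1 / α) * (2 / (1 - α) + 2) * K * T ^ (μ - (1 - α)) +
    K * (T ^ (β - α) / (β - α) + 1) * T ^ α +
    ((1 + 1 / α) * (2 / (1 - α) + 2) * (3 * K₀) + K * (T ^ (β - α) / (β - α) + 1))

theorem rpow_le_rpow_mul_rpow_sub {T v p q : ℝ} (hv : 0 < v) (hvT : v ≤ T) (hpq : p ≤ q) :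
    v ^ q ≤ T ^ (q - p) * v ^ p := by
  calc v ^ q = v ^ (q - p) * v ^ p := by rw [← Real.rpow_add hv, sub_add_cancel]
    _ ≤ _ := mul_le_mul_of_nonneg_right (Real.rpow_le_rpow hv.le hvT (by linarith))
      (Real.rpow_nonneg hv.le _)

/-- The weight `e^{λt}` is compared with the size of `x` and of its singular part at the different
scales `R` and `R λ^α`; in this scaling every term of the estimate has the same order in `λ`. -/
theorem enorm_stieltjesTo_sub_le {d m : ℕ} {T α β μ δ K γ K₀ l R : ℝ} {KN : ℝ → ℝ}
    {σ : ℝ → ℝ → Vec d → Mat d m} {g : ℝ → Vec m} {x : ℝ → Vec d}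
    (hT : 0 < T) (hα0 : 0 < α) (hα1 : α < 1) (hαβ : α < β) (hμα : 1 - α ≤ μ)
    (hγ₀ : 0 ≤ γ) (hγ₁ : γ ≤ 1) (hK : 0 < K) (hK₀ : 0 < K₀)
    (hσ : H1 T β μ δ K KN σ) (hσ' : H3 T γ K₀ σ) (hg : MemWT T α g)
    (hxm : AEStronglyMeasurable x (volume.restrict (Icc 0 T))) (hl : 1 ≤ l) (hR : 1 ≤ R)
    (hx : ∀ u ∈ Icc 0 T, ‖x u‖ ≤ R * Real.exp (l * u))
    (hψ : ∀ u ∈ Icc 0 T, singularPart α x u ≤ ENNReal.ofReal (R * l ^ α * Real.exp (l * u)))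
    {s t : ℝ} (hs : 0 ≤ s) (hst : s < t) (ht : t ≤ T) (i : Fin d) (j : Fin m) :
    ‖stieltjesTo T α (fun u => σ t u (x u) (i, j)) (fun r => g r j) t -
      stieltjesTo T α (fun u => σ s u (x u) (i, j)) (fun r => g r j) s‖ₑ ≤
      ENNReal.ofReal (Lam T α g) * ENNReal.ofReal (diffusionConst T α β μ K K₀ * R *
        Real.exp (l * t) * (l ^ (α - 1) * (t - s) ^ (1 - α) +
          min (1 / l) (t - s) ^ (1 - α))) := by
  have hl0 : 0 < l := by linarith
  have h1α : 0 < 1 - α := by linarith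
  have hβα : 0 < β - α := by linarith
  have hv : 0 < t - s := by linarith
  have htI : t ∈ Icc 0 T := ⟨hs.trans hst.le, ht⟩
  have hsI : s ∈ Icc 0 T := ⟨hs, hst.le.trans ht⟩
  have hlα : 1 ≤ l ^ α := Real.one_le_rpow hl hα0.le
  have hQ : 0 ≤ R * l ^ α := by positivity
  set c₁ := (1 + 1 / α) * (2 / (1 - α) + 2) with hc₁
  set Cβ := T ^ (β - α) / (β - α) with hCβ
  have hc₁0 : 0 ≤ c₁ := by positivity
  have hCβ0 : 0 ≤ Cβ := by positivity
  set f : ℝ → ℝ → Mat d m := fun r u => σ r u (x u) with hf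
  have hfm : ∀ r ∈ Icc 0 T, AEStronglyMeasurable (f r) (volume.restrict (Icc 0 T)) :=
    fun r hr => aestronglyMeasurable_comp_path hT hσ.measurable hxm hr
  have hsub : ∀ {p q : ℝ}, 0 ≤ p → q ≤ T → Ico p q ⊆ Icc 0 T :=
    fun hp hq u hu => ⟨hp.trans hu.1, hu.2.le.trans hq⟩
  have hfm' : ∀ r ∈ Icc 0 T, ∀ {p q : ℝ}, 0 ≤ p → q ≤ T →
      AEStronglyMeasurable (f r) (volume.restrict (Ico p q)) := fun r hr p q hp hq =>
    (hfm r hr).mono_measure (Measure.restrict_mono (hsub hp hq) le_rfl)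
  -- The integrand cut off to an interval.
  have mass1 : ∀ r ∈ Icc 0 T, ∀ p q : ℝ, 0 ≤ p → p ≤ q → q ≤ T →
      weylMass T α ((Ico p q).indicator (f r)) ≤ ENNReal.ofReal (Real.exp (l * q) *
      (c₁ * (3 * K₀ * R) * min (1 / l) (q - p) ^ (1 - α) +
        K * (Cβ + R * l ^ α) * min (1 / l) (q - p))) := by
    intro r hr p q hp hpq hq
    refine weylMass_indicator_le_exp (x := x) hα0 hα1 hαβ hl0 (by positivity) hK.le hQ hp hpq hq
      (hfm' r hr hp hq) (fun u hu => ?_) (fun u hu y hy => ?_) (fun u hu => ?_)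
    · have huI := hsub hp hq (Ioo_subset_Ico_self hu)
      have h1 : 1 ≤ R * Real.exp (l * u) :=
        one_le_mul_of_one_le_of_one_le hR (Real.one_le_exp (mul_nonneg hl0.le huI.1))
      calc ‖f r u‖ ≤ K₀ * (2 + ‖x u‖) := hσ'.norm_le hγ₀ hγ₁ hK₀ hr huI _
        _ ≤ K₀ * (3 * (R * Real.exp (l * u))) := by
            refine mul_le_mul_of_nonneg_left ?_ hK₀.le
            linarith [hx u huI]
        _ = _ := by ring
    · have huI := hsub hp hq (Ioo_subset_Ico_self hu)
      have hyI := hsub hp hq (⟨hy.1.le, hy.2.trans hu.2⟩ : y ∈ Ico p q)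
      exact hσ.norm_sub_le hr huI hyI _ _
    · exact hψ u (hsub hp hq (Ioo_subset_Ico_self hu))
  -- The difference of the two integrands on the common interval.
  have mass2 : weylMass T α ((Ico 0 s).indicator (f t - f s)) ≤ ENNReal.ofReal (Real.exp (l * s) *
      (c₁ * (K * (t - s) ^ μ) * min (1 / l) (s - 0) ^ (1 - α) +
        K * (t - s) * (Cβ + R * l ^ α) * min (1 / l) (s - 0))) := by
    refine weylMass_indicator_le_exp (x := x) hα0 hα1 hαβ hl0 (by positivity) (by positivity) hQ
      le_rfl hs hsI.2 ((hfm' t htI le_rfl hsI.2).sub (hfm' s hsI le_rfl hsI.2)) (fun u hu => ?_)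
      (fun u hu y hy => ?_) (fun u hu => ?_)
    · have huI := hsub le_rfl hsI.2 (Ioo_subset_Ico_self hu)
      have h1 := hσ.holder_t t htI s hsI u huI (x u) i
      rw [abs_of_pos hv] at h1
      have h2 : 1 ≤ Real.exp (l * u) := Real.one_le_exp (mul_nonneg hl0.le huI.1)
      calc ‖(f t - f s) u‖ ≤ K * (t - s) ^ μ :=
            le_trans (le_add_of_nonneg_right (norm_nonneg _)) h1
        _ ≤ _ := le_mul_of_one_le_right (by positivity) h2
    · have huI := hsub le_rfl hsI.2 (Ioo_subset_Ico_self hu)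
      have hyI := hsub le_rfl hsI.2 (⟨hy.1.le, hy.2.trans hu.2⟩ : y ∈ Ico 0 s)
      refine (hσ.norm_sub_sub_le hsI htI huI hyI (x u) (x y)).trans (le_of_eq ?_)
      rw [abs_of_pos hv]
      ring
    · exact hψ u (hsub le_rfl hsI.2 (Ioo_subset_Ico_self hu))
  -- Passage to components.
  set e : Mat d m → ℝ := fun A => A (i, j) with he
  have hcomp : ∀ (p q : ℝ) (r : ℝ), (Ico p q).indicator (fun u => σ r u (x u) (i, j)) =
      fun u => e ((Ico p q).indicator (f r) u) := by
    intro p q r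
    ext u
    by_cases hu : u ∈ Ico p q
    · simp [he, hf, hu, indicator]
    · simp [he, hu, indicator]
  have hcm : ∀ r ∈ Icc 0 T, ∀ q, q ≤ T →
      AEStronglyMeasurable (fun u => e ((Ico 0 q).indicator (f r) u)) volume := by
    intro r hr q hq
    exact (EuclideanSpace.proj (𝕜 := ℝ) (i, j)).continuous.comp_aestronglyMeasurable
      ((aestronglyMeasurable_indicator_iff measurableSet_Ico).2 (hfm' r hr le_rfl hq))
  have hmono : ∀ G : ℝ → Mat d m, weylMass T α (fun u => e (G u)) ≤ weylMass T α G := fun G =>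
    weylMass_mono (fun y => PiLp.norm_apply_le (G y) (i, j))
      (fun y z => PiLp.norm_apply_le (G y - G z) (i, j))
  have hcfin : ∀ r ∈ Icc 0 T, ∀ q, 0 ≤ q → q ≤ T →
      weylMass T α (fun u => e ((Ico 0 q).indicator (f r) u)) < ⊤ := fun r hr q hq hqT =>
    ((hmono _).trans (mass1 r hr 0 q le_rfl hq hqT)).trans_lt ENNReal.ofReal_lt_top
  have hwb := hg.norm_weylRight_apply_le hα0 hα1 j
  have hgj : AEStronglyMeasurable (fun r => g r j) (volume.restrict (Icc 0 T)) :=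
    (EuclideanSpace.proj (𝕜 := ℝ) j).continuous.comp_aestronglyMeasurable hg.measurable
  rw [stieltjesTo_eq hT, stieltjesTo_eq hT, hcomp, hcomp,
    ← stieltjes_sub hT hα0 hα1 (hcm t htI t ht) (hcm s hsI s hsI.2) (hcfin t htI t htI.1 ht)
      (hcfin s hsI s hs hsI.2) (aestronglyMeasurable_weylRight hgj) hwb]
  refine (enorm_stieltjes_le hT hα0 hα1 hwb).trans (mul_le_mul_right ?_ _)
  have hdec : ((fun u => e ((Ico 0 t).indicator (f t) u)) -
      fun u => e ((Ico 0 s).indicator (f s) u)) =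
      fun u => e (((Ico 0 s).indicator (f t - f s) + (Ico s t).indicator (f t)) u) := by
    ext u
    simp only [Pi.sub_apply, Pi.add_apply, he, indicator, mem_Ico]
    by_cases h0 : 0 ≤ u
    · rcases lt_or_ge u s with h | h
      · simp [h0, h, h.trans hst, not_le.2 h]
      · by_cases h' : u < t
        · simp [h0, h, h', not_lt.2 h]
        · simp [h', not_lt.2 h]
    · have h1 : ¬s ≤ u := fun h => h0 (hs.trans h)
      simp [h0, h1]
  rw [hdec]
  refine (hmono _).trans ((weylMass_add_le ((aestronglyMeasurable_indicator_iff
    measurableSet_Ico).2 ((hfm' t htI le_rfl hsI.2).sub (hfm' s hsI le_rfl hsI.2)))).trans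
    ((add_le_add mass2 (mass1 t htI s t hs hst.le ht)).trans ?_))
  -- The remaining comparison of real numbers.
  set w := min (1 / l) (t - s) with hw
  have hw0 : 0 < w := lt_min (by positivity) hv
  set w₀ := min (1 / l) (s - 0) with hw₀
  have hw₀0 : 0 ≤ w₀ := le_min (by positivity) (by linarith)
  have hw₀l : w₀ ≤ 1 / l := min_le_left _ _
  have hE : Real.exp (l * s) ≤ Real.exp (l * t) :=
    Real.exp_le_exp.2 (mul_le_mul_of_nonneg_left hst.le hl0.le)
  have hEt := Real.exp_pos (l * t)
  have r1 : w₀ ^ (1 - α) ≤ l ^ (α - 1) := by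
    calc w₀ ^ (1 - α) ≤ (1 / l) ^ (1 - α) := Real.rpow_le_rpow hw₀0 hw₀l h1α.le
      _ = l ^ (α - 1) := by
        rw [one_div, Real.inv_rpow hl0.le, ← Real.rpow_neg hl0.le, neg_sub]
  have r2 : l ^ α * w₀ ≤ l ^ (α - 1) := by
    calc l ^ α * w₀ ≤ l ^ α * (1 / l) := mul_le_mul_of_nonneg_left hw₀l (by positivity)
      _ = l ^ (α - 1) := by rw [Real.rpow_sub_one hl0.ne', mul_one_div]
  have r3 : l ^ α * w ≤ w ^ (1 - α) := by
    have hlw : l * w ≤ 1 := by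
      calc l * w ≤ l * (1 / l) := mul_le_mul_of_nonneg_left (min_le_left _ _) hl0.le
        _ = 1 := by rw [mul_one_div, div_self hl0.ne']
    calc l ^ α * w = (l * w) ^ α * w ^ (1 - α) := by
          rw [Real.mul_rpow hl0.le hw0.le, mul_assoc, ← Real.rpow_add hw0, add_sub_cancel,
            Real.rpow_one]
      _ ≤ 1 * w ^ (1 - α) := mul_le_mul_of_nonneg_right
          (Real.rpow_le_one (by positivity) hlw hα0.le) (by positivity)
      _ = _ := one_mul _
  have hvT : t - s ≤ T := by linarith
  have r4 := rpow_le_rpow_mul_rpow_sub hv hvT hμα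
  have r5 := rpow_le_rpow_mul_rpow_sub (q := 1) hv hvT (by linarith : 1 - α ≤ 1)
  rw [Real.rpow_one, sub_sub_cancel] at r5
  have r6 : Cβ + R * l ^ α ≤ (Cβ + 1) * (R * l ^ α) := by
    have : 1 ≤ R * l ^ α := one_le_mul_of_one_le_of_one_le hR hlα
    nlinarith
  rw [← ENNReal.ofReal_add (by positivity) (by positivity)]
  refine ENNReal.ofReal_le_ofReal ?_
  have k1 : c₁ * (K * (t - s) ^ μ) * w₀ ^ (1 - α) ≤
      R * (c₁ * K * T ^ (μ - (1 - α))) * (l ^ (α - 1) * (t - s) ^ (1 - α)) := by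
    calc _ ≤ c₁ * (K * (T ^ (μ - (1 - α)) * (t - s) ^ (1 - α))) * l ^ (α - 1) := by gcongr
      _ ≤ R * (c₁ * (K * (T ^ (μ - (1 - α)) * (t - s) ^ (1 - α))) * l ^ (α - 1)) :=
          le_mul_of_one_le_left (by positivity) hR
      _ = _ := by ring
  have k2 : K * (t - s) * (Cβ + R * l ^ α) * w₀ ≤
      R * (K * (Cβ + 1) * T ^ α) * (l ^ (α - 1) * (t - s) ^ (1 - α)) := by
    calc _ ≤ K * (T ^ α * (t - s) ^ (1 - α)) * ((Cβ + 1) * (R * l ^ α)) * w₀ := by gcongr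
      _ = K * (T ^ α * (t - s) ^ (1 - α)) * ((Cβ + 1) * R) * (l ^ α * w₀) := by ring
      _ ≤ K * (T ^ α * (t - s) ^ (1 - α)) * ((Cβ + 1) * R) * l ^ (α - 1) := by gcongr
      _ = _ := by ring
  have k3 : K * (Cβ + R * l ^ α) * w ≤ R * (K * (Cβ + 1)) * w ^ (1 - α) := by
    calc _ ≤ K * ((Cβ + 1) * (R * l ^ α)) * w := by gcongr
      _ = K * ((Cβ + 1) * R) * (l ^ α * w) := by ring
      _ ≤ K * ((Cβ + 1) * R) * w ^ (1 - α) := by gcongr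
      _ = _ := by ring
  set P := l ^ (α - 1) * (t - s) ^ (1 - α) with hP
  set W := w ^ (1 - α) with hW
  have hP0 : 0 ≤ P := by positivity
  have hW0 : 0 ≤ W := by positivity
  have hTμ : 0 ≤ T ^ (μ - (1 - α)) := by positivity
  have hTα : 0 ≤ T ^ α := by positivity
  calc _ ≤ Real.exp (l * t) * (R * (c₁ * K * T ^ (μ - (1 - α))) * P +
        R * (K * (Cβ + 1) * T ^ α) * P) +
        Real.exp (l * t) * (c₁ * (3 * K₀ * R) * W + R * (K * (Cβ + 1)) * W) := by
        gcongr
    _ ≤ _ := by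
        unfold diffusionConst
        rw [← hc₁, ← hCβ]
        have hR0 : 0 ≤ R := by linarith
        have n1 : 0 ≤ Real.exp (l * t) * (R * (c₁ * K * T ^ (μ - (1 - α))) * W +
          R * (K * (Cβ + 1) * T ^ α) * W) := by positivity
        have n2 : 0 ≤ Real.exp (l * t) * (c₁ * (3 * K₀ * R) * P + R * (K * (Cβ + 1)) * P) := by
          positivity
        linarith

theorem norm_le_of_abs_apply_le {d : ℕ} (v : Vec d) {c : ℝ} (h : ∀ i, ‖v i‖ ≤ c) :
    ‖v‖ ≤ d * c := by
  conv_lhs => rw [← (EuclideanSpace.basisFun (Fin d) ℝ).sum_repr v]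
  refine (norm_sum_le _ _).trans ?_
  calc ∑ i, ‖(EuclideanSpace.basisFun (Fin d) ℝ).repr v i • EuclideanSpace.basisFun (Fin d) ℝ i‖
      ≤ ∑ _i : Fin d, c := by
        refine Finset.sum_le_sum fun i _ => ?_
        rw [norm_smul, OrthonormalBasis.norm_eq_one, mul_one]
        exact h i
    _ = d * c := by simp

theorem IsSolution.apply_zero {d m : ℕ} {T α : ℝ} {b : ℝ → ℝ → Vec d → Vec d}
    {σ : ℝ → ℝ → Vec d → Mat d m} {g : ℝ → Vec m} {x₀ : Vec d} {x : ℝ → Vec d}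
    (h : IsSolution T α b σ g x₀ x) (hT : 0 ≤ T) : x 0 = x₀ := by
  ext i
  rw [h.eq 0 ⟨le_rfl, hT⟩ i]
  simp [stieltjesTo, stieltjes, weylLeft]

/-- The constant of the estimate for the increments of solutions. -/
def solutionConst (d m : ℕ) (T α β μ K L L₀ K₀ : ℝ) (B : NNReal) : ℝ :=
  d * (L * T * T ^ (μ - (1 - α)) + (L * T ^ μ * T ^ α + B * T ^ (-α)) +
    m * diffusionConst T α β μ K K₀ + L₀)

/-- The a priori bound at the scale `R` yields Hölder increments of order `1 - α`, in which `R`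
carries the small factor `1 / M` as soon as `λ ≥ M` and `M Λ_α(g) ≤ λ^{1-α}`. -/
theorem IsSolution.norm_sub_le {d m : ℕ} {T α β μ δ K γ K₀ L L₀ l R M : ℝ} {KN LN : ℝ → ℝ}
    {B : NNReal} {b : ℝ → ℝ → Vec d → Vec d}
    {σ : ℝ → ℝ → Vec d → Mat d m} {g : ℝ → Vec m} {x₀ : Vec d} {x : ℝ → Vec d}
    (hT : 0 < T) (hα0 : 0 < α) (hα1 : α < 1) (hαβ : α < β) (hμα : 1 - α ≤ μ)
    (hγ₀ : 0 ≤ γ) (hγ₁ : γ ≤ 1) (hK : 0 < K) (hK₀ : 0 < K₀) (hL : 0 < L) (hL₀ : 0 < L₀)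
    (hσ : H1 T β μ δ K KN σ) (hb : H2 T (1 / α) μ L L₀ LN B b) (hσ' : H3 T γ K₀ σ)
    (hg : MemWT T α g) (hsol : IsSolution T α b σ g x₀ x)
    (hM : 1 ≤ M) (hMl : M ≤ l) (hΛ : Lam T α g ≤ l ^ (1 - α) / M) (hR : 1 ≤ R)
    (hx : ∀ u ∈ Icc 0 T, ‖x u‖ ≤ R * Real.exp (l * u))
    (hψ : ∀ u ∈ Icc 0 T, singularPart α x u ≤ ENNReal.ofReal (R * l ^ α * Real.exp (l * u)))
    {s t : ℝ} (hs : 0 ≤ s) (hst : s < t) (ht : t ≤ T) :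
    ‖x t - x s‖ ≤ solutionConst d m T α β μ K L L₀ K₀ B * (t - s) ^ (1 - α) +
      solutionConst d m T α β μ K L L₀ K₀ B * R / M * Real.exp (l * t) *
        (l ^ (1 - α) * min (1 / l) (t - s) ^ (1 - α) + (t - s) ^ (1 - α)) := by
  have hl : 1 ≤ l := hM.trans hMl
  have hl0 : 0 < l := by linarith
  have hM0 : 0 < M := by linarith
  have h1α : 0 < 1 - α := by linarith
  have hβα : 0 < β - α := by linarith
  have hv : 0 < t - s := by linarith
  have htI : t ∈ Icc 0 T := ⟨hs.trans hst.le, ht⟩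
  have hsI : s ∈ Icc 0 T := ⟨hs, hst.le.trans ht⟩
  have hxm := hsol.mem.measurable
  have hEt := Real.exp_pos (l * t)
  set Cσ := diffusionConst T α β μ K K₀ with hCσ
  have hCσ0 : 0 ≤ Cσ := by
    rw [hCσ]; unfold diffusionConst; positivity
  have hxi : ∀ p q : ℝ, 0 ≤ p → p ≤ q → q ≤ T →
      ∫⁻ u in Ioo p q, ENNReal.ofReal (L₀ * ‖x u‖) ≤
      ENNReal.ofReal (L₀ * R * (Real.exp (l * q) * min (1 / l) (q - p))) := by
    intro p q hp hpq hq
    rw [ENNReal.ofReal_mul (by positivity)]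
    refine le_trans ?_ (mul_le_mul_right (lintegral_Ioo_exp_le hl0 hpq) _)
    rw [← lintegral_const_mul' _ _ ENNReal.ofReal_ne_top]
    refine setLIntegral_mono' measurableSet_Ioo fun u hu => ?_
    rw [← ENNReal.ofReal_mul (by positivity), mul_assoc]
    exact ENNReal.ofReal_le_ofReal (mul_le_mul_of_nonneg_left
      (hx u ⟨hp.trans hu.1.le, hu.2.le.trans hq⟩) hL₀.le)
  set w := min (1 / l) (t - s) with hw
  have hw0 : 0 < w := lt_min (by positivity) hv
  set V := (t - s) ^ (1 - α) with hV
  have hV0 : 0 ≤ V := by positivity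
  set W := l ^ (1 - α) * w ^ (1 - α) with hW
  have hW0 : 0 ≤ W := by positivity
  have hwW : w ≤ W / M := by
    have h1 : l * w ≤ 1 := by
      calc l * w ≤ l * (1 / l) := mul_le_mul_of_nonneg_left (min_le_left _ _) hl0.le
        _ = 1 := by rw [mul_one_div, div_self hl0.ne']
    have h2 : l * w ≤ W := by
      rw [hW, ← Real.mul_rpow hl0.le hw0.le]
      exact Real.self_le_rpow_of_le_one (by positivity) h1 (by linarith)
    rw [le_div_iff₀ hM0, mul_comm]
    exact (mul_le_mul_of_nonneg_right hMl hw0.le).trans h2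
  have hμ : 0 < μ := by linarith
  have hTμ : 0 ≤ T ^ (μ - (1 - α)) := by positivity
  have r4 := rpow_le_rpow_mul_rpow_sub hv (by linarith : t - s ≤ T) hμα
  set D := L * T * T ^ (μ - (1 - α)) + (L * T ^ μ * T ^ α + B * T ^ (-α)) with hD
  have hD0 : 0 ≤ D := by positivity
  have comp : ∀ i : Fin d, ‖(x t - x s) i‖ ≤
      D * V + (L₀ + m * Cσ) * R / M * Real.exp (l * t) * (W + V) := by
    intro i
    have hdrift := hb.enorm_integral_sub_le hT hα0 hα1 hμ hL hxm
      ((hxi 0 T le_rfl hT.le le_rfl).trans_lt ENNReal.ofReal_lt_top) hs hst.le ht i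
    have hdrift' := hb.lintegral_le hT hα0 hα1 hμ hL hxm htI hs hst.le ht
    have hdiff := fun j => enorm_stieltjesTo_sub_le hT hα0 hα1 hαβ hμα hγ₀ hγ₁ hK hK₀ hσ hσ' hg
      hxm hl hR hx hψ hs hst ht i j
    have e : (x t - x s) i = ((∫ u in (0 : ℝ)..t, b t u (x u) i) -
        ∫ u in (0 : ℝ)..s, b s u (x u) i) +
        ∑ j : Fin m, (stieltjesTo T α (fun u => σ t u (x u) (i, j)) (fun r => g r j) t -
          stieltjesTo T α (fun u => σ s u (x u) (i, j)) (fun r => g r j) s) := by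
      rw [PiLp.sub_apply, hsol.eq t htI i, hsol.eq s hsI i, Finset.sum_sub_distrib]
      ring
    have hΛ' : ENNReal.ofReal (Lam T α g) * ENNReal.ofReal (Cσ * R * Real.exp (l * t) *
        (l ^ (α - 1) * V + w ^ (1 - α))) ≤
        ENNReal.ofReal (Cσ * R / M * Real.exp (l * t) * (W + V)) := by
      rw [← ENNReal.ofReal_mul (Lam_nonneg hα1)]
      refine ENNReal.ofReal_le_ofReal ?_
      calc _ ≤ l ^ (1 - α) / M * (Cσ * R * Real.exp (l * t) *
            (l ^ (α - 1) * V + w ^ (1 - α))) := by gcongr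
        _ = Cσ * R / M * Real.exp (l * t) * (W + (l ^ (1 - α) * l ^ (α - 1)) * V) := by
            rw [hW]; ring
        _ = _ := by
            rw [← Real.rpow_add hl0, show 1 - α + (α - 1) = 0 by ring, Real.rpow_zero, one_mul]
    have tot : ‖(x t - x s) i‖ₑ ≤ (ENNReal.ofReal (L * T * (t - s) ^ μ) +
        (ENNReal.ofReal (L₀ * R * (Real.exp (l * t) * w)) +
          ENNReal.ofReal ((L * T ^ μ * T ^ α + B * T ^ (-α)) * V))) +
        ∑ _j : Fin m, ENNReal.ofReal (Cσ * R / M * Real.exp (l * t) * (W + V)) := by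
      rw [e]
      refine (enorm_add_le _ _).trans (add_le_add ?_ ?_)
      · exact hdrift.trans (add_le_add le_rfl
          (hdrift'.trans (add_le_add (hxi s t hs hst.le ht) le_rfl)))
      · exact (enorm_sum_le _ _).trans (Finset.sum_le_sum fun j _ => (hdiff j).trans hΛ')
    rw [Finset.sum_const, Finset.card_univ, Fintype.card_fin, nsmul_eq_mul,
      ← ENNReal.ofReal_natCast, ← ENNReal.ofReal_mul (by positivity),
      ← ENNReal.ofReal_add (by positivity) (by positivity),
      ← ENNReal.ofReal_add (by positivity) (by positivity),
      ← ENNReal.ofReal_add (by positivity) (by positivity), ← ofReal_norm,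
      ENNReal.ofReal_le_ofReal_iff (by positivity)] at tot
    refine tot.trans ?_
    have k1 : L * T * (t - s) ^ μ ≤ L * T * T ^ (μ - (1 - α)) * V := by
      rw [mul_assoc (L * T)]; gcongr
    have k2 : L₀ * R * (Real.exp (l * t) * w) ≤ L₀ * R / M * Real.exp (l * t) * (W + V) := by
      calc _ ≤ L₀ * R * (Real.exp (l * t) * (W / M)) := by gcongr
        _ = L₀ * R / M * Real.exp (l * t) * W := by ring
        _ ≤ _ := by gcongr; linarith
    calc _ ≤ (L * T * T ^ (μ - (1 - α)) * V + (L₀ * R / M * Real.exp (l * t) * (W + V) +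
          (L * T ^ μ * T ^ α + B * T ^ (-α)) * V)) +
          m * (Cσ * R / M * Real.exp (l * t) * (W + V)) := by gcongr
      _ = _ := by rw [hD]; ring
  refine (norm_le_of_abs_apply_le _ comp).trans ?_
  have hsc : solutionConst d m T α β μ K L L₀ K₀ B = d * (D + m * Cσ + L₀) := rfl
  have hmC : 0 ≤ (m : ℝ) * Cσ := by positivity
  have h1 : D ≤ D + m * Cσ + L₀ := by linarith
  have h2 : L₀ + m * Cσ ≤ D + m * Cσ + L₀ := by linarith
  rw [hsc]
  generalize D + m * Cσ + L₀ = S at h1 h2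
  calc (d : ℝ) * (D * V + (L₀ + m * Cσ) * R / M * Real.exp (l * t) * (W + V))
      ≤ d * (S * V + S * R / M * Real.exp (l * t) * (W + V)) := by gcongr
    _ = _ := by ring

/-! ### Absorption and conclusion -/

/-- Bounds for the increments are turned into bounds for `|x|` and its singular part. -/
theorem singularPart_le_of_norm_sub_le {E : Type*} [NormedAddCommGroup E] {T α l C P t : ℝ}
    {x : ℝ → E} (hα0 : 0 < α) (hα1 : α < 1 / 2) (hl : 1 ≤ l) (hC : 0 ≤ C) (hP : 0 ≤ P)
    (ht : t ∈ Icc 0 T)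
    (h : ∀ s ∈ Ioo 0 t, ‖x t - x s‖ ≤ C * (t - s) ^ (1 - α) + P * Real.exp (l * t) *
      (l ^ (1 - α) * min (1 / l) (t - s) ^ (1 - α) + (t - s) ^ (1 - α))) :
    singularPart α x t ≤ ENNReal.ofReal ((C * (T ^ (1 - 2 * α) / (1 - 2 * α)) +
      P * (1 / (1 - 2 * α) + 1 / α + T ^ (1 - 2 * α) / (1 - 2 * α))) * l ^ α *
        Real.exp (l * t)) := by
  have hl0 : 0 < l := by linarith
  have h2α : 0 < 1 - 2 * α := by linarith
  have hT : 0 ≤ T := ht.1.trans ht.2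
  have hE := Real.exp_pos (l * t)
  have hE1 : 1 ≤ Real.exp (l * t) := Real.one_le_exp (mul_nonneg hl0.le ht.1)
  have hlα : 1 ≤ l ^ α := Real.one_le_rpow hl hα0.le
  have e0 : l ^ (1 - α) * l ^ (2 * α - 1) = l ^ α := by
    rw [← Real.rpow_add hl0]; congr 1; ring
  set c₃ := T ^ (1 - 2 * α) / (1 - 2 * α) with hc₃
  set c₂ := 1 / (1 - 2 * α) + 1 / α with hc₂
  have hc₃0 : 0 ≤ c₃ := by positivity
  have hc₂0 : 0 ≤ c₂ := by positivity
  have i1 : ∫⁻ s in Ioo 0 t, ENNReal.ofReal ((t - s) ^ (-2 * α)) ≤ ENNReal.ofReal c₃ := by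
    rw [lintegral_Ioo_sub_right_rpow (by linarith) ht.1, sub_zero,
      show -2 * α + 1 = 1 - 2 * α by ring]
    exact ENNReal.ofReal_le_ofReal (div_le_div_of_nonneg_right
      (Real.rpow_le_rpow ht.1 ht.2 h2α.le) h2α.le)
  calc singularPart α x t ≤ ∫⁻ s in Ioo 0 t,
        (ENNReal.ofReal (C + P * Real.exp (l * t)) * ENNReal.ofReal ((t - s) ^ (-2 * α)) +
        ENNReal.ofReal (P * Real.exp (l * t) * l ^ (1 - α)) *
          ENNReal.ofReal (min (1 / l) (t - s) ^ (1 - α) / (t - s) ^ (α + 1))) := by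
        refine setLIntegral_mono' measurableSet_Ioo fun s hs => ?_
        have h0 : 0 < t - s := by linarith [hs.2]
        have hw : 0 < min (1 / l) (t - s) := lt_min (by positivity) h0
        have e1 : (t - s) ^ (-2 * α) = (t - s) ^ (1 - α) / (t - s) ^ (α + 1) := by
          rw [← Real.rpow_sub h0]; congr 1; ring
        rw [← ENNReal.ofReal_mul (by positivity), ← ENNReal.ofReal_mul (by positivity),
          ← ENNReal.ofReal_add (by positivity) (by positivity)]
        refine ENNReal.ofReal_le_ofReal ?_
        rw [e1, ← mul_div_assoc, ← mul_div_assoc, ← add_div]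
        refine div_le_div_of_nonneg_right ((h s hs).trans (le_of_eq ?_)) (by positivity)
        ring
    _ = ENNReal.ofReal (C + P * Real.exp (l * t)) *
          (∫⁻ s in Ioo 0 t, ENNReal.ofReal ((t - s) ^ (-2 * α))) +
        ENNReal.ofReal (P * Real.exp (l * t) * l ^ (1 - α)) * ∫⁻ s in Ioo 0 t,
          ENNReal.ofReal (min (1 / l) (t - s) ^ (1 - α) / (t - s) ^ (α + 1)) := by
        rw [lintegral_add_left (by fun_prop), lintegral_const_mul' _ _ ENNReal.ofReal_ne_top,
          lintegral_const_mul' _ _ ENNReal.ofReal_ne_top]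
    _ ≤ ENNReal.ofReal (C + P * Real.exp (l * t)) * ENNReal.ofReal c₃ +
        ENNReal.ofReal (P * Real.exp (l * t) * l ^ (1 - α)) *
          ENNReal.ofReal (c₂ * l ^ (2 * α - 1)) :=
        add_le_add (mul_le_mul_right i1 _)
          (mul_le_mul_right (lintegral_rpow_mul_min_le hα0 hα1 hl0) _)
    _ ≤ _ := by
        rw [← ENNReal.ofReal_mul (by positivity), ← ENNReal.ofReal_mul (by positivity),
          ← ENNReal.ofReal_add (by positivity) (by positivity)]
        refine ENNReal.ofReal_le_ofReal ?_
        have k1 : C * c₃ ≤ C * c₃ * (l ^ α * Real.exp (l * t)) :=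
          le_mul_of_one_le_right (by positivity) (one_le_mul_of_one_le_of_one_le hlα hE1)
        have k2 : P * Real.exp (l * t) * c₃ ≤ P * Real.exp (l * t) * c₃ * l ^ α :=
          le_mul_of_one_le_right (by positivity) hlα
        have k3 : P * Real.exp (l * t) * l ^ (1 - α) * (c₂ * l ^ (2 * α - 1)) =
            P * Real.exp (l * t) * c₂ * l ^ α := by
          rw [← e0]; ring
        rw [k3]
        linarith

/-- If a family of bounds `P R` holds for some large `R` and each `R ≥ 1` may be replaced by
`A + R / 2`, then it holds for `R` arbitrarily close to `1 + 2 * A`. -/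
theorem bound_of_half_contraction {P : ℝ → Prop} {A N : ℝ} (hA : 0 ≤ A) (hN : 0 ≤ N)
    (h0 : P (1 + 2 * A + N)) (hmono : ∀ R R', R ≤ R' → P R → P R')
    (hstep : ∀ R, 1 ≤ R → P R → P (A + R / 2)) (n : ℕ) : P (1 + 2 * A + N * (1 / 2) ^ n) := by
  induction n with
  | zero => simpa using h0
  | succ n ih =>
    refine hmono _ _ ?_ (hstep _ ?_ ih)
    · rw [pow_succ]; linarith
    · have : 0 ≤ N * (1 / 2 : ℝ) ^ n := by positivity
      linarith

theorem le_of_forall_half_pow {a b N : ℝ} (h : ∀ n : ℕ, a ≤ b + N * (1 / 2) ^ n) : a ≤ b := by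
  have : Filter.Tendsto (fun n : ℕ => b + N * (1 / 2 : ℝ) ^ n) Filter.atTop (nhds (b + N * 0)) :=
    ((tendsto_pow_atTop_nhds_zero_of_lt_one (by norm_num) (by norm_num)).const_mul N).const_add b
  rw [mul_zero, add_zero] at this
  exact ge_of_tendsto' this h

/-- The a priori estimate at a scale `λ` that dominates `Λ_α(g)^{1/(1-α)}`. -/
theorem IsSolution.normW0_le {d m : ℕ} {T α β μ δ K γ K₀ L L₀ l M : ℝ} {KN LN : ℝ → ℝ}
    {B : NNReal} {b : ℝ → ℝ → Vec d → Vec d}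
    {σ : ℝ → ℝ → Vec d → Mat d m} {g : ℝ → Vec m} {x₀ : Vec d} {x : ℝ → Vec d}
    (hT : 0 < T) (hα0 : 0 < α) (hα1 : α < 1 / 2) (hαβ : α < β) (hμα : 1 - α ≤ μ)
    (hγ₀ : 0 ≤ γ) (hγ₁ : γ ≤ 1) (hK : 0 < K) (hK₀ : 0 < K₀) (hL : 0 < L) (hL₀ : 0 < L₀)
    (hσ : H1 T β μ δ K KN σ) (hb : H2 T (1 / α) μ L L₀ LN B b) (hσ' : H3 T γ K₀ σ)
    (hg : MemWT T α g) (hsol : IsSolution T α b σ g x₀ x)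
    {C c₂ c₃ c₄ : ℝ} (hC : C = solutionConst d m T α β μ K L L₀ K₀ B) (hC0 : 0 ≤ C)
    (hc₂ : c₂ = 1 / (1 - 2 * α) + 1 / α) (hc₃ : c₃ = T ^ (1 - 2 * α) / (1 - 2 * α))
    (hc₄ : c₄ = T ^ (1 - α))
    (hM : M = 1 + 2 * C * (c₂ + c₃ + (1 + c₄))) (hMl : M ≤ l)
    (hΛ : Lam T α g ≤ l ^ (1 - α) / M) :
    normW0 T α x ≤ ENNReal.ofReal
      ((1 + 2 * (‖x₀‖ + C * c₄ + C * c₃)) * (1 + l ^ α) * Real.exp (l * T)) := by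
  have h2α : 0 < 1 - 2 * α := by linarith
  have hc₂0 : 0 ≤ c₂ := by rw [hc₂]; positivity
  have hc₃0 : 0 ≤ c₃ := by rw [hc₃]; positivity
  have hc₄0 : 0 ≤ c₄ := by rw [hc₄]; positivity
  have hM1 : 1 ≤ M := by
    have : 0 ≤ 2 * C * (c₂ + c₃ + (1 + c₄)) := by positivity
    linarith
  have hM0 : 0 < M := by linarith
  have hl : 1 ≤ l := hM1.trans hMl
  have hl0 : 0 < l := by linarith
  have hlα : 1 ≤ l ^ α := Real.one_le_rpow hl hα0.le
  set A := ‖x₀‖ + C * c₄ + C * c₃ with hA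
  have hA0 : 0 ≤ A := by positivity
  set N := (normW0 T α x).toReal with hN
  have hN0 : 0 ≤ N := ENNReal.toReal_nonneg
  have hNx : ∀ u ∈ Icc 0 T, ENNReal.ofReal ‖x u‖ + singularPart α x u ≤ ENNReal.ofReal N := by
    intro u hu
    rw [hN, ENNReal.ofReal_toReal hsol.mem.norm_lt_top.ne]
    exact le_iSup₂_of_le u hu le_rfl
  have hE1 : ∀ u ∈ Icc 0 T, 1 ≤ Real.exp (l * u) := fun u hu =>
    Real.one_le_exp (mul_nonneg hl0.le hu.1)
  have key := bound_of_half_contraction (A := A) (N := N)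
    (P := fun R => ∀ u ∈ Icc 0 T, ‖x u‖ ≤ R * Real.exp (l * u) ∧
      singularPart α x u ≤ ENNReal.ofReal (R * l ^ α * Real.exp (l * u))) hA0 hN0 ?_ ?_ ?_
  rotate_left
  · intro u hu
    have hE := hE1 u hu
    have h1 : N ≤ (1 + 2 * A + N) * Real.exp (l * u) :=
      (by linarith : N ≤ 1 + 2 * A + N).trans (le_mul_of_one_le_right (by positivity) hE)
    refine ⟨?_, ?_⟩
    · exact ((ENNReal.ofReal_le_ofReal_iff hN0).1 (le_self_add.trans (hNx u hu))).trans h1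
    · refine (le_add_self.trans (hNx u hu)).trans (ENNReal.ofReal_le_ofReal (h1.trans ?_))
      rw [mul_right_comm]
      exact le_mul_of_one_le_right (by positivity) hlα
  · intro R R' hRR h u hu
    refine ⟨(h u hu).1.trans ?_, (h u hu).2.trans (ENNReal.ofReal_le_ofReal ?_)⟩ <;> gcongr
  · intro R hR h t ht
    have hR0 : 0 ≤ R := by linarith
    have hE := Real.exp_pos (l * t)
    have hE' := hE1 t ht
    have hinc : ∀ s, 0 ≤ s → s < t → ‖x t - x s‖ ≤ C * (t - s) ^ (1 - α) +
        C * R / M * Real.exp (l * t) *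
          (l ^ (1 - α) * min (1 / l) (t - s) ^ (1 - α) + (t - s) ^ (1 - α)) := by
      intro s hs hst
      rw [hC]
      exact hsol.norm_sub_le hT hα0 (by linarith) hαβ hμα hγ₀ hγ₁ hK hK₀ hL hL₀ hσ hb hσ' hg hM1
        hMl hΛ hR (fun u hu => (h u hu).1) (fun u hu => (h u hu).2) hs hst ht.2
    have hCM : ∀ c, 0 ≤ c → c ≤ c₂ + c₃ + (1 + c₄) → C * R / M * c ≤ R / 2 := by
      intro c hc hcle
      have h1 : C * c ≤ C * (c₂ + c₃ + (1 + c₄)) := by gcongr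
      rw [div_mul_eq_mul_div, div_le_iff₀ hM0]
      nlinarith
    refine ⟨?_, ?_⟩
    · rcases ht.1.eq_or_lt with h0 | h0
      · rw [← h0, hsol.apply_zero hT.le, mul_zero, Real.exp_zero, mul_one]
        have : 0 ≤ C * c₄ + C * c₃ := by positivity
        linarith
      have h1 := hinc 0 le_rfl h0
      rw [sub_zero, hsol.apply_zero hT.le] at h1
      have hw : 0 < min (1 / l) t := lt_min (by positivity) h0
      have h2 : t ^ (1 - α) ≤ c₄ := by
        rw [hc₄]; exact Real.rpow_le_rpow ht.1 ht.2 (by linarith)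
      have h3 : l ^ (1 - α) * min (1 / l) t ^ (1 - α) ≤ 1 := by
        rw [← Real.mul_rpow hl0.le hw.le]
        refine Real.rpow_le_one (by positivity) ?_ (by linarith)
        calc l * min (1 / l) t ≤ l * (1 / l) :=
              mul_le_mul_of_nonneg_left (min_le_left _ _) hl0.le
          _ = 1 := by rw [mul_one_div, div_self hl0.ne']
      have h4 : ‖x t - x₀‖ ≤ C * c₄ + R / 2 * Real.exp (l * t) := by
        calc _ ≤ C * c₄ + C * R / M * Real.exp (l * t) * (1 + c₄) := by
              refine h1.trans ?_
              gcongr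
          _ = C * c₄ + C * R / M * (1 + c₄) * Real.exp (l * t) := by ring
          _ ≤ _ := by
              gcongr
              exact hCM _ (by positivity) (by linarith)
      have h5 : ‖x₀‖ + C * c₄ ≤ A * Real.exp (l * t) := by
        have : 0 ≤ C * c₃ := by positivity
        exact (by linarith : ‖x₀‖ + C * c₄ ≤ A).trans (le_mul_of_one_le_right hA0 hE')
      have h6 := norm_le_norm_add_norm_sub' (x t) x₀
      rw [add_mul]
      linarith
    · refine (singularPart_le_of_norm_sub_le hα0 hα1 hl hC0 (P := C * R / M) (by positivity) ht
        fun s hs => hinc s hs.1.le hs.2).trans (ENNReal.ofReal_le_ofReal ?_)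
      rw [← hc₂, ← hc₃]
      have h1 := hCM (c₂ + c₃) (by positivity) (by linarith)
      have h2 : C * c₃ ≤ A := by
        have : 0 ≤ C * c₄ := by positivity
        linarith [norm_nonneg x₀]
      gcongr
  refine iSup₂_le fun t ht => ?_
  have hE := Real.exp_pos (l * t)
  have hET : Real.exp (l * t) ≤ Real.exp (l * T) :=
    Real.exp_le_exp.2 (mul_le_mul_of_nonneg_left ht.2 hl0.le)
  have hfin : singularPart α x t ≠ ⊤ :=
    ((le_add_self.trans (hNx t ht)).trans_lt ENNReal.ofReal_lt_top).ne
  have b1 : ‖x t‖ ≤ (1 + 2 * A) * Real.exp (l * t) := by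
    refine le_of_forall_half_pow (N := N * Real.exp (l * t)) fun n => ?_
    refine ((key n) t ht).1.trans (le_of_eq ?_)
    ring
  have b2 : (singularPart α x t).toReal ≤ (1 + 2 * A) * l ^ α * Real.exp (l * t) := by
    refine le_of_forall_half_pow (N := N * l ^ α * Real.exp (l * t)) fun n => ?_
    refine (ENNReal.toReal_le_of_le_ofReal (by positivity) ((key n) t ht).2).trans (le_of_eq ?_)
    ring
  change ENNReal.ofReal ‖x t‖ + singularPart α x t ≤ _
  rw [← ENNReal.ofReal_toReal hfin, ← ENNReal.ofReal_add (norm_nonneg _) ENNReal.toReal_nonneg]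
  refine ENNReal.ofReal_le_ofReal ?_
  calc _ ≤ (1 + 2 * A) * Real.exp (l * t) + (1 + 2 * A) * l ^ α * Real.exp (l * t) :=
        add_le_add b1 b2
    _ = (1 + 2 * A) * (1 + l ^ α) * Real.exp (l * t) := by ring
    _ ≤ _ := by gcongr

theorem IsExponent.one_div_le {α γ φ : ℝ} (h : IsExponent α γ φ) (hα0 : 0 < α)
    (hα1 : α < 1 / 2) : 1 / (1 - α) ≤ φ := by
  have : 1 / (1 - α) ≤ 1 / (1 - 2 * α) :=
    one_div_le_one_div_of_le (by linarith) (by linarith)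
  rcases h with ⟨-, -, h⟩ | ⟨-, -, h⟩ | ⟨-, h⟩
  · exact h.ge
  · exact this.trans h.le
  · exact this.trans h.ge

theorem rpow_le_one_add_rpow {a p q : ℝ} (ha : 0 ≤ a) (hp : 0 ≤ p) (hpq : p ≤ q) :
    a ^ p ≤ 1 + a ^ q := by
  rcases le_total a 1 with h | h
  · linarith [Real.rpow_le_one ha h hp, Real.rpow_nonneg ha q]
  · linarith [Real.rpow_le_rpow_of_exponent_le h hpq]

end Volterra

end

theorem mainTheorem3 (d m : ℕ) (T : ℝ) (hT : 0 < T)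
    (α β μ δ γ φ : ℝ)
    (hβ₀ : 0 < β) (hβ₁ : β ≤ 1) (hμ₀ : 0 < μ) (hμ₁ : μ ≤ 1) (hδ₀ : 0 < δ) (hδ₁ : δ ≤ 1)
    (hmin : 1 - μ < min β (δ / (1 + δ)))
    (hμα : 0 < 1 - μ) (hα : 1 - μ < α) (hα₀ : α < min (1 / 2) (min β (δ / (1 + δ))))
    (hγ₀ : 0 ≤ γ) (hγ₁ : γ ≤ 1) (hφ : Volterra.IsExponent α γ φ)
    (K : ℝ) (hK : 0 < K) (KN : ℝ → ℝ) (hKN : ∀ N : ℝ, 0 ≤ N → 0 < KN N)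
    (L : ℝ) (hL : 0 < L) (L₀ : ℝ) (hL₀ : 0 < L₀)
    (LN : ℝ → ℝ) (hLN : ∀ N : ℝ, 0 ≤ N → 0 < LN N) (B : NNReal)
    (K₀ : ℝ) (hK₀ : 0 < K₀) :
    ∃ C₅ C₆ : ℝ, 0 < C₅ ∧ 0 < C₆ ∧
      ∀ (b : ℝ → ℝ → Volterra.Vec d → Volterra.Vec d)
        (σ : ℝ → ℝ → Volterra.Vec d → Volterra.Mat d m)
        (g : ℝ → Volterra.Vec m) (x₀ : Volterra.Vec d) (x : ℝ → Volterra.Vec d),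
        Volterra.H1 T β μ δ K KN σ →
        Volterra.H2 T (1 / α) μ L L₀ LN B b →
        Volterra.H3 T γ K₀ σ →
        Volterra.MemWT T α g →
        Volterra.IsSolution T α b σ g x₀ x →
        Volterra.normW0 T α x ≤
          ENNReal.ofReal (C₅ * (1 + ‖x₀‖) * Real.exp (C₆ * Volterra.Lam T α g ^ φ)) := by
  have hα0 : 0 < α := hμα.trans hα
  have hα1 : α < 1 / 2 := hα₀.trans_le (min_le_left _ _)
  have hαβ : α < β := hα₀.trans_le ((min_le_right _ _).trans (min_le_left _ _))
  have h1α : 0 < 1 - α := by linarith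
  have h2α : 0 < 1 - 2 * α := by linarith
  have hβα : 0 < β - α := by linarith
  obtain ⟨C, hC⟩ : ∃ C, C = Volterra.solutionConst d m T α β μ K L L₀ K₀ B := ⟨_, rfl⟩
  have hC0 : 0 ≤ C := by
    rw [hC]; unfold Volterra.solutionConst Volterra.diffusionConst; positivity
  obtain ⟨c₂, hc₂⟩ : ∃ c₂, c₂ = 1 / (1 - 2 * α) + 1 / α := ⟨_, rfl⟩
  obtain ⟨c₃, hc₃⟩ : ∃ c₃, c₃ = T ^ (1 - 2 * α) / (1 - 2 * α) := ⟨_, rfl⟩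
  obtain ⟨c₄, hc₄⟩ : ∃ c₄, c₄ = T ^ (1 - α) := ⟨_, rfl⟩
  obtain ⟨M, hM⟩ : ∃ M, M = 1 + 2 * C * (c₂ + c₃ + (1 + c₄)) := ⟨_, rfl⟩
  have hc₂0 : 0 ≤ c₂ := by rw [hc₂]; positivity
  have hc₃0 : 0 ≤ c₃ := by rw [hc₃]; positivity
  have hc₄0 : 0 ≤ c₄ := by rw [hc₄]; positivity
  have hM1 : 1 ≤ M := by
    have : 0 ≤ 2 * C * (c₂ + c₃ + (1 + c₄)) := by positivity
    linarith
  have hM0 : 0 < M := by linarith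
  set p := 1 / (1 - α) with hp
  have hp0 : 0 < p := by positivity
  refine ⟨2 * (1 + 2 * (1 + C * c₄ + C * c₃)) * Real.exp ((T + 1) * (M + M ^ p)),
    (T + 1) * M ^ p, by positivity, by positivity, ?_⟩
  intro b σ g x₀ x hσ hb hσ' hg hsol
  have hΛ0 : 0 ≤ Volterra.Lam T α g := Volterra.Lam_nonneg (by linarith)
  set Λ := Volterra.Lam T α g with hΛ
  -- The scale is chosen so that `M ≤ λ` and `M Λ ≤ λ ^ (1 - α)`.
  obtain ⟨l, hl⟩ : ∃ l, l = M + (M * Λ) ^ p := ⟨_, rfl⟩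
  have hMl : M ≤ l := by
    rw [hl]; exact le_add_of_nonneg_right (by positivity)
  have hl1 : 1 ≤ l := hM1.trans hMl
  have hl0 : 0 < l := by linarith
  have hΛl : Λ ≤ l ^ (1 - α) / M := by
    rw [le_div_iff₀ hM0, mul_comm]
    calc M * Λ = ((M * Λ) ^ p) ^ (1 - α) := by
          rw [← Real.rpow_mul (by positivity), hp, one_div_mul_cancel h1α.ne', Real.rpow_one]
      _ ≤ l ^ (1 - α) := by
          refine Real.rpow_le_rpow (by positivity) ?_ h1α.le
          rw [hl]; linarith
  refine (hsol.normW0_le hT hα0 hα1 hαβ (by linarith) hγ₀ hγ₁ hK hK₀ hL hL₀ hσ hb hσ' hg hC hC0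
    hc₂ hc₃ hc₄ hM hMl hΛl).trans (ENNReal.ofReal_le_ofReal ?_)
  have h1 : 1 + l ^ α ≤ 2 * Real.exp l := by
    have e1 : l ^ α ≤ l := by
      calc l ^ α ≤ l ^ (1 : ℝ) := Real.rpow_le_rpow_of_exponent_le hl1 (by linarith)
        _ = l := Real.rpow_one l
    have e2 := Real.add_one_le_exp l
    linarith
  have h2 : l ≤ M + M ^ p + M ^ p * Λ ^ φ := by
    rw [hl, Real.mul_rpow hM0.le hΛ0, add_assoc]
    have := mul_le_mul_of_nonneg_left
      (Volterra.rpow_le_one_add_rpow hΛ0 hp0.le (hφ.one_div_le hα0 hα1))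
      (Real.rpow_nonneg hM0.le p)
    linarith
  have h3 : 1 + 2 * (‖x₀‖ + C * c₄ + C * c₃) ≤
      (1 + 2 * (1 + C * c₄ + C * c₃)) * (1 + ‖x₀‖) := by
    have e1 : 0 ≤ C * c₄ + C * c₃ := by positivity
    have e2 := norm_nonneg x₀
    nlinarith [mul_nonneg e1 e2]
  have h4 : Real.exp l * Real.exp (l * T) ≤ Real.exp ((T + 1) * (M + M ^ p)) *
      Real.exp ((T + 1) * M ^ p * Λ ^ φ) := by
    rw [← Real.exp_add, ← Real.exp_add]
    refine Real.exp_le_exp.2 ?_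
    calc l + l * T = (T + 1) * l := by ring
      _ ≤ (T + 1) * (M + M ^ p + M ^ p * Λ ^ φ) := by gcongr
      _ = _ := by ring
  calc _ ≤ ((1 + 2 * (1 + C * c₄ + C * c₃)) * (1 + ‖x₀‖)) * (2 * Real.exp l) *
        Real.exp (l * T) := by gcongr
    _ = 2 * ((1 + 2 * (1 + C * c₄ + C * c₃)) * (1 + ‖x₀‖)) *
        (Real.exp l * Real.exp (l * T)) := by ring
    _ ≤ 2 * ((1 + 2 * (1 + C * c₄ + C * c₃)) * (1 + ‖x₀‖)) *
        (Real.exp ((T + 1) * (M + M ^ p)) * Real.exp ((T + 1) * M ^ p * Λ ^ φ)) := by gcongr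
    _ = _ := by ring
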